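/- Setting. For $N\ge 1$ spins one half on a line with lattice spacing $a>0$ (distance $d_{ij}=a|i-j|$), let $$H_s=-\sum_{i=1}^{N-1}\sigma^z_i\sigma^z_{i+1}-\sum_{i=1}^N\left(g\sigma^x_i+h\sigma^z_i\right),\qquad g,h\in\mathbb R$$ (in particular for the chaotic chain $g=-1.05$, $h=0.5$), and let every spin $k$ be subject, at rate $\Gamma$, either to phase damping ($L_k=\sqrt{1/2}\,\sigma^z_k$) or to phase depolarizing ($L_k=\tfrac12\sigma^x_k,\tfrac12\sigma^y_k,\tfrac12\sigma^z_k$). Let $\mathcal V_f(t)=e^{t\mathcal L}$ with $\mathcal L X=-i[H_s,X]+\sum_L\frac\Gamma2(2LXL^\dagger-XL^\dagger L-L^\dagger LX)$, and let $\mathcal V_b^\dagger(t)=e^{t\mathcal L_b^\dagger}$ with $\mathcal L_b^\dagger O=-i[H_s,O]+\sum_L\frac\Gamma2(2L^\dagger OL-OL^\dagger L-L^\dagger LO)$ (adjoint evolution with reversed Hamiltonian and unchanged dissipation). The dissipative OTOC at infinite temperature is $$F(t,A,B)=\mathrm{Re}\,\mathrm{tr}\Big(\big(\mathcal V_b^\dagger(t)B^\dagger\big)\,A\,\big(\mathcal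 V_f(t)(B\,2^{-N})\big)\,A^\dagger\Big),$$ and the corrected OTOC is $F(t,A,B)/F(t,I,B)$. Here $A=\sigma^\alpha_i$, $B=\sigma^\beta_j$ are local Pauli operators. Let $\|O\|$ be the operator norm, $\|O\|_F=\sqrt{\mathrm{tr}(OO^\dagger)/2^N}$, $B_0(t)=e^{-itH_s}Be^{itH_s}$ and $F_0(t,A,B)=\mathrm{Re}\,\mathrm{tr}(A^\dagger B_0(t)^\dagger AB_0(t))/2^N$ (the chain without dissipation). Call $v>0$ a Lieb-Robinson velocity with constants $c,\xi>0$ if $\|[O_B(t),O_A]\|\le c\|O_A\|\|O_B\|e^{-(d_{ij}-vt)/\xi}$ for the chain without dissipation, for all $N$, $t\ge0$ and Hermitian $O_A,O_B$ acting on single sites $i,j$, where $O_B(t)=e^{-itH_s}O_Be^{itH_s}$. For $0<\varepsilon<1$, say that the corrected OTOC reveals the light cone at time $t$ if, for all $N$, all sites $i,j$ and all $\alpha,\beta$, $F(t,I,B)>0$ and, with $S=\sqrt{2(1-F(t,A,B)/F(t,I,B))}$, $$\frac{\|[B_0(t),A]\|_F-2\varepsilon}{1+\varepsilon}\le S\le\frac{\|[B_0(t),A]\|_F+2\varepsilon}{1-\varepsilon},\qquad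 \Big|\frac{F(t,A,B)}{F(t,I,B)}-F_0(t,A,B)\Big|\le4\varepsilon,\qquad S\le\frac{c\,e^{-(d_{ij}-vt)/\xi}+2\varepsilon}{1-\varepsilon}.$$ The width of the revealed light cone $d=vt$ is the supremum of all $R$ such that the light cone is revealed at all $t\ge0$ with $vt\le R$. Corollary. (1) Lieb-Robinson velocities exist. (2) $\mathcal V_b^\dagger(t)=\mathcal V_f(t)$ for phase damping and phase depolarizing. (3) For these channels $F(t,I,B)>0$ and $$2\Big(1-\frac{F(t,A,B)}{F(t,I,B)}\Big)=\frac{\|[\mathcal V_b^\dagger(t)B,A]\|_F^2}{\|\mathcal V_b^\dagger(t)B\|_F^2}.$$ (4) For every $c>0$ there is $\kappa>0$, depending only on $c$, such that for both channels, all $g,h$, all $a>0$, all Lieb-Robinson velocities $v_{LR}$ with constants $c,\xi$, all $0<\varepsilon<1$ and all $0<\Gamma\le\kappa\,\varepsilon a v_{LR}/\max(\xi,a)^2$: the corrected OTOC reveals the light cone at all times $0\le t\le\sqrt{\varepsilon a/(v_{LR}\Gamma)}$, and the width of the revealed light cone is at least $\sqrt{\varepsilon a v_{LR}/\Gamma}$.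 -/

import Mathlib

open scoped Matrix Matrix.Norms.L2Operator ENNReal

namespace DissipativeOTOC

noncomputable section

/-- Basis labels of a chain of `N` spins one half. -/
abbrev Spins (N : ℕ) := Fin N → Fin 2

/-- Operators on the Hilbert space of `N` spins; `‖O‖` is the operator norm. -/
abbrev Op (N : ℕ) := Matrix (Spins N) (Spins N) ℂ

/-- Super-operators, with the composition product (and the topology needed for exponentials). -/
abbrev SuperOp (N : ℕ) := Op N →L[ℂ] Op N

/-- The three axes of a spin. -/
inductive Axis
  | x
  | y
  | z

/-- The Pauli matrices. -/
def pauli : Axis → Matrix (Fin 2) (Fin 2) ℂ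
  | .x => !![0, 1; 1, 0]
  | .y => !![0, -Complex.I; Complex.I, 0]
  | .z => !![1, 0; 0, -1]

/-- The operator acting as `M` on the `k`-th spin and as the identity on all other spins. -/
def siteOp {N : ℕ} (k : Fin N) (M : Matrix (Fin 2) (Fin 2) ℂ) : Op N :=
  Matrix.of fun s s' => if ∀ l, l ≠ k → s l = s' l then M (s k) (s' k) else 0

/-- The local Pauli operator `σ^α_k`. -/
def sigma {N : ℕ} (k : Fin N) (α : Axis) : Op N := siteOp k (pauli α)

/-- The Ising chain with open boundary conditions, transverse field `g`, longitudinal field `h`: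
`H = - ∑_{i=1}^{N-1} σ^z_i σ^z_{i+1} - ∑_{i=1}^N (g σ^x_i + h σ^z_i)`. -/
def isingH (N : ℕ) (g h : ℝ) : Op N :=
  -(∑ i : Fin N, ∑ j : Fin N, if (i : ℕ) + 1 = j then sigma i .z * sigma j .z else 0)
    - ∑ i : Fin N, ((g : ℂ) • sigma i .x + (h : ℂ) • sigma i .z)

/-- The two types of dissipation. -/
inductive Dissipation
  | phaseDamping
  | phaseDepolarizing

/-- The Lindblad operators acting on one spin. -/
def Dissipation.jumps : Dissipation → List (Matrix (Fin 2) (Fin 2) ℂ)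
  | .phaseDamping => [((√(1 / 2) : ℝ) : ℂ) • pauli .z]
  | .phaseDepolarizing =>
      [(1 / 2 : ℂ) • pauli .x, (1 / 2 : ℂ) • pauli .y, (1 / 2 : ℂ) • pauli .z]

/-- The Lindblad operators of the whole chain: every spin carries its own copy. -/
def chainJumps (N : ℕ) (D : Dissipation) : List (Op N) :=
  (List.finRange N).flatMap fun k => D.jumps.map (siteOp k)

/-- The super-operator `X ↦ P * X * Q`. -/
def sandwich {N : ℕ} (P Q : Op N) : SuperOp N :=
  LinearMap.toContinuousLinearMap ((LinearMap.mulLeft ℂ P).comp (LinearMap.mulRight ℂ Q))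

/-- The Liouvillian
`X ↦ -i[H, X] + ∑_L Γ/2 (2 L X L† - X L† L - L† L X)` (the sum is over the list `Ls`). -/
def liouvillian {N : ℕ} (H : Op N) (Γ : ℝ) (Ls : List (Op N)) : SuperOp N :=
  (-Complex.I) • (sandwich H 1 - sandwich 1 H) +
    ((Γ / 2 : ℝ) : ℂ) • (Ls.map fun L =>
      (2 : ℂ) • sandwich L Lᴴ - sandwich 1 (Lᴴ * L) - sandwich (Lᴴ * L) 1).sum

/-- The adjoint Liouvillian
`O ↦ i[H, O] + ∑_L Γ/2 (2 L† O L - O L† L - L† L O)`. -/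
def adjointLiouvillian {N : ℕ} (H : Op N) (Γ : ℝ) (Ls : List (Op N)) : SuperOp N :=
  Complex.I • (sandwich H 1 - sandwich 1 H) +
    ((Γ / 2 : ℝ) : ℂ) • (Ls.map fun L =>
      (2 : ℂ) • sandwich Lᴴ L - sandwich 1 (Lᴴ * L) - sandwich (Lᴴ * L) 1).sum

/-- The forward dynamical map `𝒱_f(t)`: solution operator of the master equation with
Hamiltonian `H_s`. -/
def forwardMap (N : ℕ) (D : Dissipation) (g h Γ t : ℝ) : SuperOp N :=
  NormedSpace.exp ((t : ℂ) • liouvillian (isingH N g h) Γ (chainJumps N D))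

/-- The backward adjoint dynamical map `𝒱_b†(t)`: solution operator of the adjoint master equation
with Hamiltonian `-H_s` and unchanged dissipation. -/
def backwardAdjointMap (N : ℕ) (D : Dissipation) (g h Γ t : ℝ) : SuperOp N :=
  NormedSpace.exp ((t : ℂ) • adjointLiouvillian (-isingH N g h) Γ (chainJumps N D))

/-- The dissipative out-of-time-ordered correlator at infinite temperature (`ρ_s(0) = I / 2^N`),
`F(t, A, B) = Re tr ((𝒱_b†(t) · B†) A (𝒱_f(t) · (B ρ_s(0))) A†)`. -/
def otoc (N : ℕ) (D : Dissipation) (g h Γ t : ℝ) (A B : Op N) : ℝ :=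
  (Matrix.trace (backwardAdjointMap N D g h Γ t Bᴴ * A *
    forwardMap N D g h Γ t (B * (((2 : ℂ) ^ N)⁻¹ • (1 : Op N))) * Aᴴ)).re

/-- The corrected OTOC `F(t, A, B) / F(t, I, B)`. -/
def correctedOtoc (N : ℕ) (D : Dissipation) (g h Γ t : ℝ) (A B : Op N) : ℝ :=
  otoc N D g h Γ t A B / otoc N D g h Γ t 1 B

/-- The commutator `[X, Y]`. -/
def comm {N : ℕ} (X Y : Op N) : Op N := X * Y - Y * X

/-- The normalized Frobenius norm `√(tr (O O†) / 2^N)`. -/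
def frob {N : ℕ} (O : Op N) : ℝ := √((Matrix.trace (O * Oᴴ)).re / 2 ^ N)

/-- Evolution in the closed chain (no dissipation) under the reversed Hamiltonian `-H_s`:
`B ↦ e^{-itH_s} B e^{itH_s}`. -/
def closedEvolution (N : ℕ) (g h t : ℝ) (B : Op N) : Op N :=
  NormedSpace.exp ((-(Complex.I * t)) • isingH N g h) * B *
    NormedSpace.exp ((Complex.I * t) • isingH N g h)

/-- The OTOC `Re ⟨A† B_b†(t) A B_b(t)⟩` of the closed chain at infinite temperature. -/
def closedOtoc (N : ℕ) (g h t : ℝ) (A B : Op N) : ℝ :=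
  (Matrix.trace (Aᴴ * (closedEvolution N g h t B)ᴴ * A * closedEvolution N g h t B)).re / 2 ^ N

/-- Distance between two sites of the chain with lattice spacing `a`. -/
def siteDist {N : ℕ} (a : ℝ) (i j : Fin N) : ℝ := a * |((i : ℕ) : ℝ) - ((j : ℕ) : ℝ)|

/-- `v` is a Lieb-Robinson velocity of the chain, with prefactor `c` and length `ξ`:
`‖[O_B(t), O_A]‖ ≤ c ‖O_A‖ ‖O_B‖ exp (-(d_BA - v t) / ξ)` for local Hermitian observables,
uniformly in the length of the chain. -/
def IsLiebRobinson (g h a c ξ v : ℝ) : Prop :=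
  ∀ (N : ℕ) (i j : Fin N) (P Q : Matrix (Fin 2) (Fin 2) ℂ), P.IsHermitian → Q.IsHermitian →
    ∀ t : ℝ, 0 ≤ t →
      ‖comm (closedEvolution N g h t (siteOp j Q)) (siteOp i P)‖ ≤
        c * ‖(siteOp i P : Op N)‖ * ‖(siteOp j Q : Op N)‖ *
          Real.exp (-(siteDist a i j - v * t) / ξ)

/-- The signal `√(2 (1 - F(t,A,B) / F(t,I,B)))` extracted from the corrected OTOC. It is to be
compared with the signal `‖[B_b(t), A]‖_F` of the closed chain. -/
def correctedSignal (N : ℕ) (D : Dissipation) (g h Γ t : ℝ) (A B : Op N) : ℝ :=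
  √(2 * (1 - correctedOtoc N D g h Γ t A B))

/-- At time `t` the corrected OTOC reveals the light cone with resolution `ε`. For all chain
lengths, all sites and all local Pauli operators `A`, `B`:
* the corrected OTOC is well defined;
* its signal equals that of the closed chain up to the error produced by a perturbation of
  relative size `ε` of `B_b(t)` (here `‖[·, A]‖ = 2` and `‖B‖ = ‖B‖_F = 1`);
* its values agree with those of the OTOC of the closed chain up to `4 ε`;
* outside of the cone `d = v t` its signal is exponentially small up to the same error. -/
def RevealedAt (D : Dissipation) (g h a c ξ v ε Γ t : ℝ) : Prop :=
  ∀ (N : ℕ) (i j : Fin N) (α β : Axis),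
    0 < otoc N D g h Γ t 1 (sigma j β) ∧
    (frob (comm (closedEvolution N g h t (sigma j β)) (sigma i α)) - 2 * ε) / (1 + ε) ≤
      correctedSignal N D g h Γ t (sigma i α) (sigma j β) ∧
    correctedSignal N D g h Γ t (sigma i α) (sigma j β) ≤
      (frob (comm (closedEvolution N g h t (sigma j β)) (sigma i α)) + 2 * ε) / (1 - ε) ∧
    |correctedOtoc N D g h Γ t (sigma i α) (sigma j β) -
      closedOtoc N g h t (sigma i α) (sigma j β)| ≤ 4 * ε ∧
    correctedSignal N D g h Γ t (sigma i α) (sigma j β) ≤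
      (c * Real.exp (-(siteDist a i j - v * t) / ξ) + 2 * ε) / (1 - ε)

/-- The part of the light cone `d = v t` with `d ≤ R` is revealed by the corrected OTOC. -/
def RevealedOutTo (D : Dissipation) (g h a c ξ v ε Γ R : ℝ) : Prop :=
  ∀ t : ℝ, 0 ≤ t → v * t ≤ R → RevealedAt D g h a c ξ v ε Γ t

/-- The width of the light cone revealed by the corrected OTOC: the largest distance
out to which the light cone is revealed. -/
def lightConeWidth (D : Dissipation) (g h a c ξ v ε Γ : ℝ) : ℝ≥0∞ :=
  ⨆ (R : ℝ) (_ : RevealedOutTo D g h a c ξ v ε Γ R), ENNReal.ofReal R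

end

end DissipativeOTOC

/-! Everything takes place in the Hilbert space of operators with the normalized Hilbert-Schmidt
inner product. All jump operators are Hermitian, so the dissipator of site k is Γ/2 (R_k - 1) with
R_k a self-adjoint involution (`siteReflection_involutive`, `inner_siteReflection`), hence an
isometry. The same hermiticity identifies 𝒱_b† with 𝒱_f. For Hermitian unitary A, B and X(t) =
𝒱_f(t) B this gives F(t,A,B) = Re⟨X, AXA⟩, so the corrected signal is ‖[X,A]‖/‖X‖
(`correctedSignal_eq`). This ratio does not change when X is rescaled by a positive factor, so it
suffices that X be close to a positive multiple of the closed evolution b(t).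

The multiple is found by counting sites. Outside the cone of radius vt the Lieb-Robinson bound makes
R_k b - b exponentially small; inside there are at most p = 2vt/a + 1 sites. Since each R_k b has
norm 1, the sum of R_k b - b over all sites lies within p plus a constant of -p b
(`norm_hs_sum_siteReflection_le`). Let λ solve λ' = -(Γ/2) p λ, λ(0) = 1. The difference u = X - λb
obeys the Lindblad equation, which does not increase the norm, with a source of size at most (Γ/2) λ
(p + const). As (Γ/2) λ p = -λ', integration gives ‖u‖ ≤ 1 - λ + const·Γt
(`norm_hs_forwardMap_sub_le`).

Relative to λ this is about Γvt²/(2a) to leading order, that is ε/2 at t = √(εa/(vΓ)). Comparing X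
with b itself would give the full ε; the factor λ thus leaves the room in which the lower order
terms are absorbed when Γ is small (`relative_error_le`). The existence of a Lieb-Robinson velocity
is a separate Gronwall argument with exponential weights. -/

namespace DissipativeOTOC

/-! ### Algebra of one-site operators and Pauli matrices. -/

section SiteOperators

variable {N : ℕ}

/-- A row of a one-site matrix is supported on the configurations that differ from s at k only; this
collapses its matrix products to a sum over one spin. -/
lemma sum_agree_off (k : Fin N) (s : Spins N) (f : Spins N → ℂ)
    (hf : ∀ r : Spins N, (¬ ∀ l, l ≠ k → s l = r l) → f r = 0) :
    ∑ r, f r = ∑ x, f (Function.update s k x) := by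
  symm
  refine Fintype.sum_of_injective (fun x => Function.update s k x)
    (Function.update_injective s k) _ _ ?_ (fun _ => rfl)
  intro r hr
  refine hf r fun h => hr ⟨r k, ?_⟩
  funext l
  by_cases hl : l = k
  · subst hl; simp
  · simp [Function.update_of_ne hl, h l hl]

lemma siteOp_mul_apply (k : Fin N) (M : Matrix (Fin 2) (Fin 2) ℂ) (O : Op N) (s s' : Spins N) :
    (siteOp k M * O) s s' = ∑ x, M (s k) x * O (Function.update s k x) s' := by
  rw [Matrix.mul_apply, sum_agree_off k s]
  · refine Finset.sum_congr rfl fun x _ => ?_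
    have : ∀ l, l ≠ k → s l = Function.update s k x l := fun l hl => by
      simp [Function.update_of_ne hl]
    simp only [siteOp, Matrix.of_apply, if_pos this, Function.update_self]
  · intro r hr
    simp only [siteOp, Matrix.of_apply, if_neg hr, zero_mul]

lemma siteOp_mul (k : Fin N) (M M' : Matrix (Fin 2) (Fin 2) ℂ) :
    (siteOp k M * siteOp k M' : Op N) = siteOp k (M * M') := by
  ext s s'
  rw [siteOp_mul_apply]
  have key : ∀ x, (∀ l, l ≠ k → Function.update s k x l = s' l) ↔ ∀ l, l ≠ k → s l = s' l :=
    fun x => forall₂_congr fun l hl => by rw [Function.update_of_ne hl]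
  simp only [siteOp, Matrix.of_apply, key, Function.update_self, Matrix.mul_apply]
  split_ifs <;> simp

lemma siteOp_mul_of_ne_apply {k l : Fin N} (hkl : k ≠ l) (M M' : Matrix (Fin 2) (Fin 2) ℂ)
    (s s' : Spins N) :
    (siteOp k M * siteOp l M' : Op N) s s' =
      if ∀ m, m ≠ k → m ≠ l → s m = s' m then M (s k) (s' k) * M' (s l) (s' l) else 0 := by
  rw [siteOp_mul_apply, Finset.sum_eq_single (s' k)]
  · have key : (∀ m, m ≠ l → Function.update s k (s' k) m = s' m) ↔
        ∀ m, m ≠ k → m ≠ l → s m = s' m := by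
      refine forall_congr' fun m => ?_
      by_cases hm : m = k
      · subst hm; simp
      · simp [hm]
    simp only [siteOp, Matrix.of_apply, key, Function.update_of_ne hkl.symm]
    split_ifs <;> simp
  · intro x _ hx
    have : ¬ ∀ m, m ≠ l → Function.update s k x m = s' m := fun h => hx (by simpa using h k hkl)
    simp only [siteOp, Matrix.of_apply, if_neg this, mul_zero]
  · simp

lemma siteOp_commute {k l : Fin N} (hkl : k ≠ l) (M M' : Matrix (Fin 2) (Fin 2) ℂ) :
    Commute (siteOp k M : Op N) (siteOp l M') := by
  ext s s'
  rw [siteOp_mul_of_ne_apply hkl, siteOp_mul_of_ne_apply hkl.symm]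
  have : (∀ m, m ≠ k → m ≠ l → s m = s' m) ↔ ∀ m, m ≠ l → m ≠ k → s m = s' m :=
    forall_congr' fun m => ⟨fun h a b => h b a, fun h a b => h b a⟩
  simp only [this, mul_comm]

lemma siteOp_one (k : Fin N) : (siteOp k 1 : Op N) = 1 := by
  ext s s'
  simp only [siteOp, Matrix.of_apply, Matrix.one_apply]
  by_cases h : s = s'
  · simp [h]
  · by_cases h2 : ∀ l, l ≠ k → s l = s' l
    · have : s k ≠ s' k := fun hk => h (funext fun l => by
        by_cases hl : l = k
        · rw [hl, hk]
        · exact h2 l hl)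
      simp [this, h]
    · simp [h2, h]

lemma siteOp_conjTranspose (k : Fin N) (M : Matrix (Fin 2) (Fin 2) ℂ) :
    (siteOp k M : Op N)ᴴ = siteOp k Mᴴ := by
  ext s s'
  simp only [siteOp, Matrix.conjTranspose_apply, Matrix.of_apply, eq_comm (a := s' _)]
  split_ifs <;> simp

lemma siteOp_add (k : Fin N) (M M' : Matrix (Fin 2) (Fin 2) ℂ) :
    (siteOp k (M + M') : Op N) = siteOp k M + siteOp k M' := by
  ext s s'
  simp only [siteOp, Matrix.of_apply, Matrix.add_apply]
  split_ifs <;> simp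

lemma siteOp_smul (k : Fin N) (c : ℂ) (M : Matrix (Fin 2) (Fin 2) ℂ) :
    (siteOp k (c • M) : Op N) = c • siteOp k M := by
  ext s s'
  simp only [siteOp, Matrix.of_apply, Matrix.smul_apply]
  split_ifs <;> simp

lemma pauli_isHermitian (α : Axis) : (pauli α).IsHermitian := by
  ext i j
  cases α <;> fin_cases i <;> fin_cases j <;> simp [pauli]

lemma pauli_mul_self (α : Axis) : pauli α * pauli α = 1 := by
  cases α <;> simp [pauli, Matrix.one_fin_two]

lemma sigma_conjTranspose (k : Fin N) (α : Axis) : (sigma k α : Op N)ᴴ = sigma k α := by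
  rw [sigma, siteOp_conjTranspose, (pauli_isHermitian α).eq]

lemma sigma_mul_self (k : Fin N) (α : Axis) : (sigma k α : Op N) * sigma k α = 1 := by
  rw [sigma, siteOp_mul, pauli_mul_self, siteOp_one]

lemma sigma_commute {k l : Fin N} (hkl : k ≠ l) (α β : Axis) :
    Commute (sigma k α : Op N) (sigma l β) := siteOp_commute hkl _ _

lemma sigma_mem_unitary (k : Fin N) (α : Axis) : (sigma k α : Op N) ∈ unitary (Op N) := by
  rw [Unitary.mem_iff, Matrix.star_eq_conjTranspose, sigma_conjTranspose]
  exact ⟨sigma_mul_self k α, sigma_mul_self k α⟩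

lemma norm_sigma (k : Fin N) (α : Axis) : ‖(sigma k α : Op N)‖ = 1 :=
  CStarRing.norm_of_mem_unitary (sigma_mem_unitary k α)

lemma sigma_xy (k : Fin N) : (sigma k .x : Op N) * sigma k .y = Complex.I • sigma k .z := by
  rw [sigma, sigma, sigma, siteOp_mul, ← siteOp_smul]
  congr 1
  simp [pauli]

lemma sigma_yx (k : Fin N) : (sigma k .y : Op N) * sigma k .x = (-Complex.I) • sigma k .z := by
  rw [sigma, sigma, sigma, siteOp_mul, ← siteOp_smul]
  congr 1
  simp [pauli]

lemma sigma_yz (k : Fin N) : (sigma k .y : Op N) * sigma k .z = Complex.I • sigma k .x := by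
  rw [sigma, sigma, sigma, siteOp_mul, ← siteOp_smul]
  congr 1
  simp [pauli]

lemma sigma_zy (k : Fin N) : (sigma k .z : Op N) * sigma k .y = (-Complex.I) • sigma k .x := by
  rw [sigma, sigma, sigma, siteOp_mul, ← siteOp_smul]
  congr 1
  simp [pauli]

lemma sigma_zx (k : Fin N) : (sigma k .z : Op N) * sigma k .x = Complex.I • sigma k .y := by
  rw [sigma, sigma, sigma, siteOp_mul, ← siteOp_smul]
  congr 1
  simp [pauli]

lemma sigma_xz (k : Fin N) : (sigma k .x : Op N) * sigma k .z = (-Complex.I) • sigma k .y := by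
  rw [sigma, sigma, sigma, siteOp_mul, ← siteOp_smul]
  congr 1
  simp [pauli]

/-- The precise structure constants are irrelevant for the Lieb-Robinson estimate: only closure of
the Pauli set and the factor 2 enter. -/
lemma sigma_comm_same (k : Fin N) (α β : Axis) :
    ∃ (z : ℂ) (γ : Axis), ‖z‖ ≤ 2 ∧ comm (sigma k α : Op N) (sigma k β) = z • sigma k γ := by
  have h0 : ‖(0 : ℂ)‖ ≤ 2 := by simp
  have h1 : ‖(2 * Complex.I : ℂ)‖ ≤ 2 := by simp
  have h2 : ‖(-(2 * Complex.I) : ℂ)‖ ≤ 2 := by simp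
  cases α <;> cases β
  · exact ⟨0, .x, h0, by simp [comm]⟩
  · exact ⟨_, .z, h1, by rw [comm, sigma_xy, sigma_yx]; module⟩
  · exact ⟨_, .y, h2, by rw [comm, sigma_xz, sigma_zx]; module⟩
  · exact ⟨_, .z, h2, by rw [comm, sigma_xy, sigma_yx]; module⟩
  · exact ⟨0, .x, h0, by simp [comm]⟩
  · exact ⟨_, .x, h1, by rw [comm, sigma_yz, sigma_zy]; module⟩
  · exact ⟨_, .y, h1, by rw [comm, sigma_xz, sigma_zx]; module⟩
  · exact ⟨_, .x, h2, by rw [comm, sigma_yz, sigma_zy]; module⟩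
  · exact ⟨0, .x, h0, by simp [comm]⟩

lemma isingH_isHermitian (N : ℕ) (g h : ℝ) : (isingH N g h)ᴴ = isingH N g h := by
  simp only [isingH, Matrix.conjTranspose_sub, Matrix.conjTranspose_neg, Matrix.conjTranspose_sum,
    Matrix.conjTranspose_add, Matrix.conjTranspose_smul, sigma_conjTranspose, Complex.star_def,
    Complex.conj_ofReal]
  congr 2
  refine Finset.sum_congr rfl fun i _ => Finset.sum_congr rfl fun j _ => ?_
  split_ifs with hij
  · have : i ≠ j := fun e => by subst e; omega
    rw [Matrix.conjTranspose_mul, sigma_conjTranspose, sigma_conjTranspose,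
      (sigma_commute this _ _).eq]
  · simp

end SiteOperators

/-! ### Commutator identities. -/

section Commutators

variable {N : ℕ}

lemma comm_mul_left (X Y Z : Op N) : comm (X * Y) Z = X * comm Y Z + comm X Z * Y := by
  simp only [comm]; noncomm_ring

lemma comm_add_left (X Y Z : Op N) : comm (X + Y) Z = comm X Z + comm Y Z := by
  simp only [comm]; noncomm_ring

lemma comm_sub_left (X Y Z : Op N) : comm (X - Y) Z = comm X Z - comm Y Z := by
  simp only [comm]; noncomm_ring

lemma comm_smul_left (c : ℂ) (X Z : Op N) : comm (c • X) Z = c • comm X Z := by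
  simp [comm, smul_sub]

lemma norm_comm_le (X Y : Op N) : ‖comm X Y‖ ≤ 2 * ‖X‖ * ‖Y‖ := by
  calc ‖comm X Y‖ ≤ ‖X * Y‖ + ‖Y * X‖ := norm_sub_le _ _
    _ ≤ ‖X‖ * ‖Y‖ + ‖Y‖ * ‖X‖ := add_le_add (norm_mul_le _ _) (norm_mul_le _ _)
    _ = 2 * ‖X‖ * ‖Y‖ := by ring

end Commutators

/-! ### Unitary evolution of the closed chain. -/

section ClosedEvolution

variable {N : ℕ} (g h : ℝ)

lemma exp_mul_exp_isingH (t : ℝ) :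
    NormedSpace.exp ((Complex.I * t) • isingH N g h) *
      NormedSpace.exp ((-(Complex.I * t)) • isingH N g h) = 1 := by
  have hc := (Commute.refl ((Complex.I * t) • isingH N g h)).neg_right
  rw [neg_smul, ← Matrix.exp_add_of_commute _ _ hc, add_neg_cancel, NormedSpace.exp_zero]

lemma exp_mul_exp_isingH' (t : ℝ) :
    NormedSpace.exp ((-(Complex.I * t)) • isingH N g h) *
      NormedSpace.exp ((Complex.I * t) • isingH N g h) = 1 := by
  have hc := (Commute.refl ((Complex.I * t) • isingH N g h)).neg_left
  rw [neg_smul, ← Matrix.exp_add_of_commute _ _ hc, neg_add_cancel, NormedSpace.exp_zero]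

lemma exp_isingH_conjTranspose (t : ℝ) :
    (NormedSpace.exp ((Complex.I * t) • isingH N g h))ᴴ =
      NormedSpace.exp ((-(Complex.I * t)) • isingH N g h) := by
  rw [← Matrix.exp_conjTranspose, Matrix.conjTranspose_smul, isingH_isHermitian]
  simp

lemma exp_isingH_mem_unitary (t : ℝ) :
    NormedSpace.exp ((Complex.I * t) • isingH N g h) ∈ unitary (Op N) := by
  rw [Unitary.mem_iff, Matrix.star_eq_conjTranspose, exp_isingH_conjTranspose]
  exact ⟨exp_mul_exp_isingH' g h t, exp_mul_exp_isingH g h t⟩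

lemma exp_neg_isingH_mem_unitary (t : ℝ) :
    NormedSpace.exp ((-(Complex.I * t)) • isingH N g h) ∈ unitary (Op N) := by
  rw [← exp_isingH_conjTranspose]
  exact Unitary.star_mem (exp_isingH_mem_unitary g h t)

lemma closedEvolution_mul (t : ℝ) (A B : Op N) :
    closedEvolution N g h t (A * B) = closedEvolution N g h t A * closedEvolution N g h t B := by
  simp only [closedEvolution]
  simp only [mul_assoc]
  rw [← mul_assoc (NormedSpace.exp ((Complex.I * t) • isingH N g h))
    (NormedSpace.exp ((-(Complex.I * t)) • isingH N g h)), exp_mul_exp_isingH, one_mul]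

lemma closedEvolution_one (t : ℝ) : closedEvolution N g h t 1 = 1 := by
  rw [closedEvolution, mul_one, exp_mul_exp_isingH']

lemma closedEvolution_add (t : ℝ) (A B : Op N) :
    closedEvolution N g h t (A + B) = closedEvolution N g h t A + closedEvolution N g h t B := by
  simp only [closedEvolution, mul_add, add_mul]

lemma closedEvolution_sub (t : ℝ) (A B : Op N) :
    closedEvolution N g h t (A - B) = closedEvolution N g h t A - closedEvolution N g h t B := by
  simp only [closedEvolution, mul_sub, sub_mul]

lemma closedEvolution_smul (t : ℝ) (c : ℂ) (A : Op N) :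
    closedEvolution N g h t (c • A) = c • closedEvolution N g h t A := by
  simp [closedEvolution]

lemma closedEvolution_comm (t : ℝ) (A B : Op N) :
    closedEvolution N g h t (comm A B) =
      comm (closedEvolution N g h t A) (closedEvolution N g h t B) := by
  rw [comm, comm, closedEvolution_sub, closedEvolution_mul, closedEvolution_mul]

lemma closedEvolution_neg_cancel (t : ℝ) (A : Op N) :
    closedEvolution N g h t (closedEvolution N g h (-t) A) = A := by
  simp only [closedEvolution, Complex.ofReal_neg, mul_neg, neg_neg]
  simp only [mul_assoc]
  rw [exp_mul_exp_isingH', mul_one, ← mul_assoc, exp_mul_exp_isingH', one_mul]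

lemma closedEvolution_zero (A : Op N) : closedEvolution N g h 0 A = A := by
  simp [closedEvolution]

lemma norm_closedEvolution (t : ℝ) (A : Op N) : ‖closedEvolution N g h t A‖ = ‖A‖ := by
  rw [closedEvolution, CStarRing.norm_mul_mem_unitary _ (exp_isingH_mem_unitary g h t),
    CStarRing.norm_mem_unitary_mul _ (exp_neg_isingH_mem_unitary g h t)]

lemma hasDerivAt_exp_isingH (z : ℂ) (t : ℝ) :
    HasDerivAt (fun t : ℝ => NormedSpace.exp ((z * t) • isingH N g h))
      (z • (isingH N g h * NormedSpace.exp ((z * t) • isingH N g h))) t := by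
  have h1 := hasDerivAt_exp_smul_const' (𝕂 := ℂ) (isingH N g h) (z * t)
  have h2 : HasDerivAt (fun t : ℝ => z * (t : ℂ)) z t := by
    simpa using (Complex.ofRealCLM.hasDerivAt (x := t)).const_mul z
  exact h1.scomp t h2

lemma isingH_commute_exp (z : ℂ) :
    Commute (isingH N g h) (NormedSpace.exp (z • isingH N g h)) :=
  ((Commute.refl _).smul_right z).exp_right

lemma hasDerivAt_closedEvolution (t : ℝ) (B : Op N) :
    HasDerivAt (fun t : ℝ => closedEvolution N g h t B)
      ((-Complex.I) • comm (isingH N g h) (closedEvolution N g h t B)) t := by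
  have h1 := hasDerivAt_exp_isingH (N := N) g h (-Complex.I) t
  have h2 := hasDerivAt_exp_isingH (N := N) g h Complex.I t
  have h3 := (h1.mul_const B).mul h2
  simp only [neg_mul] at h3
  have h4 : ∀ H E E' : Op N, H * E' = E' * H →
      ((-Complex.I) • (H * E)) * B * E' + E * B * (Complex.I • (H * E')) =
        (-Complex.I) • comm H (E * B * E') := fun H E E' hE => by
    simp only [comm, hE, smul_mul_assoc, mul_smul_comm, smul_sub, neg_smul, neg_mul, mul_assoc]
    abel
  exact h3.congr_deriv (h4 _ _ _ (isingH_commute_exp g h (Complex.I * t)).eq)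

lemma closedEvolution_isingH (t : ℝ) :
    closedEvolution N g h t (isingH N g h) = isingH N g h := by
  rw [closedEvolution, ← (isingH_commute_exp g h _).eq, mul_assoc, exp_mul_exp_isingH', mul_one]

end ClosedEvolution

/-! ### The dissipator as a sum of one-site reflections. -/

section Reflections

variable {N : ℕ}

/-- The superoperator `R` on site `k` such that the dissipator of that site is `Γ/2 (R - 1)`. -/
noncomputable def siteReflection (D : Dissipation) (k : Fin N) (O : Op N) : Op N :=
  match D with
  | .phaseDamping => sigma k .z * O * sigma k .z
  | .phaseDepolarizing =>
      (1 / 2 : ℂ) • (sigma k .x * O * sigma k .x + sigma k .y * O * sigma k .y +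
        sigma k .z * O * sigma k .z - O)

lemma sandwich_apply (P Q O : Op N) : sandwich P Q O = P * O * Q := by
  simp [sandwich, mul_assoc]

lemma sum_map_flatMap {ι κ A : Type*} [AddCommMonoid A] (l : List ι) (f : ι → List κ)
    (F : κ → A) : ((l.flatMap f).map F).sum = (l.map fun k => ((f k).map F).sum).sum := by
  induction l with
  | nil => simp
  | cons a l ih => simp [ih]

lemma liouvillian_apply (D : Dissipation) (H : Op N) (Γ : ℝ) (O : Op N) :
    liouvillian H Γ (chainJumps N D) O =
      (-Complex.I) • comm H O + ((Γ / 2 : ℝ) : ℂ) • ∑ k, (siteReflection D k O - O) := by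
  rw [liouvillian, chainJumps, sum_map_flatMap, ← Fin.sum_univ_def]
  rw [add_apply, smul_apply, smul_apply,
    sum_apply, sub_apply, sandwich_apply, sandwich_apply]
  congr 2
  · simp [comm]
  · refine Finset.sum_congr rfl fun k _ => ?_
    have hs : ((√(1 / 2) : ℝ) : ℂ) * ((√(1 / 2) : ℝ) : ℂ) = 1 / 2 := by
      rw [← Complex.ofReal_mul, Real.mul_self_sqrt (by norm_num)]; norm_num
    cases D
    · simp only [Dissipation.jumps, List.map_cons, List.map_nil, List.sum_cons, List.sum_nil,
        add_zero, sub_apply, smul_apply, sandwich_apply,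
        siteOp_smul, Matrix.conjTranspose_smul, Complex.star_def, Complex.conj_ofReal,
        siteReflection, ← sigma.eq_1, sigma_conjTranspose, smul_mul_assoc, mul_smul_comm, smul_smul,
        mul_assoc, sigma_mul_self, one_mul, mul_one, hs]
      module
    · simp only [Dissipation.jumps, List.map_cons, List.map_nil, List.sum_cons, List.sum_nil,
        add_zero, sub_apply, add_apply,
        smul_apply, sandwich_apply,
        siteOp_smul, Matrix.conjTranspose_smul, Complex.star_def, map_div₀, map_one, map_ofNat,
        siteReflection, ← sigma.eq_1, sigma_conjTranspose, smul_mul_assoc, mul_smul_comm, smul_smul,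
        mul_assoc, sigma_mul_self, one_mul, mul_one]
      module

lemma chainJumps_hermitian (D : Dissipation) (L : Op N) (hL : L ∈ chainJumps N D) : Lᴴ = L := by
  simp only [chainJumps, List.mem_flatMap, List.mem_map] at hL
  obtain ⟨k, -, M, hM, rfl⟩ := hL
  rw [siteOp_conjTranspose]
  congr 1
  cases D <;> simp only [Dissipation.jumps, List.mem_cons, List.not_mem_nil, or_false] at hM
  · rw [hM, Matrix.conjTranspose_smul, (pauli_isHermitian _).eq]
    simp
  · rcases hM with rfl | rfl | rfl <;>
    rw [Matrix.conjTranspose_smul, (pauli_isHermitian _).eq] <;> simp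

/-- Taking the adjoint reverses the sign of the Hamiltonian term and replaces L by L†. Reversing H
undoes the first change, and hermiticity of L makes the second void. -/
lemma backwardAdjointMap_eq_forwardMap (D : Dissipation) (g h Γ t : ℝ) (N : ℕ) :
    backwardAdjointMap N D g h Γ t = forwardMap N D g h Γ t := by
  rw [backwardAdjointMap, forwardMap]
  congr 2
  rw [adjointLiouvillian, liouvillian]
  congr 1
  · ext1 O
    simp only [sub_apply, smul_apply, sandwich_apply]
    simp [smul_sub]
  · congr 2
    refine List.map_congr_left fun L hL => ?_
    rw [chainJumps_hermitian D L hL]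

lemma siteReflection_conjTranspose (D : Dissipation) (k : Fin N) (O : Op N) :
    (siteReflection D k O)ᴴ = siteReflection D k Oᴴ := by
  cases D <;> simp [siteReflection, sigma_conjTranspose, mul_assoc]

lemma siteReflection_sub (D : Dissipation) (k : Fin N) (A B : Op N) :
    siteReflection D k (A - B) = siteReflection D k A - siteReflection D k B := by
  cases D <;> simp only [siteReflection, mul_sub, sub_mul]
  module

lemma siteReflection_smul (D : Dissipation) (k : Fin N) (c : ℂ) (A : Op N) :
    siteReflection D k (c • A) = c • siteReflection D k A := by
  cases D <;> simp only [siteReflection, mul_smul_comm, smul_mul_assoc]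
  module

/-- Depending on the factor at site k, phase damping fixes 1 and σ^z and flips σ^x and σ^y;
depolarizing fixes 1 and flips all three Pauli matrices. All eigenvalues are therefore ±1. -/
lemma siteReflection_involutive (D : Dissipation) (k : Fin N) (O : Op N) :
    siteReflection D k (siteReflection D k O) = O := by
  cases D
  · simp only [siteReflection]
    calc _ = (sigma k .z * sigma k .z) * O * (sigma k .z * sigma k .z) := by noncomm_ring
      _ = O := by rw [sigma_mul_self, one_mul, mul_one]
  · have h3 : ∀ P Q : Op N, P * (Q * O * Q) * P = (P * Q) * O * (Q * P) := fun P Q => by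
      noncomm_ring
    simp only [siteReflection, mul_smul_comm, smul_mul_assoc, mul_add, add_mul, mul_sub, sub_mul, h3,
      sigma_mul_self, sigma_xy, sigma_yx, sigma_yz, sigma_zy, sigma_zx, sigma_xz, one_mul, mul_one,
      smul_smul, neg_mul, mul_neg, Complex.I_mul_I, neg_neg, one_smul]
    module

end Reflections

/-! ### Hilbert-Schmidt geometry of operators. -/

section HilbertSchmidt

variable {N : ℕ}

/-- Operators as vectors, so that the norm becomes the normalized Frobenius norm. -/
noncomputable def hs : Op N →ₗ[ℂ] EuclideanSpace ℂ (Spins N × Spins N) where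
  toFun O := (((√(2 ^ N))⁻¹ : ℝ) : ℂ) • WithLp.toLp 2 fun p => O p.1 p.2
  map_add' A B := by
    rw [← smul_add]
    rfl
  map_smul' c A := by
    rw [smul_comm]
    rfl

lemma inner_hs (X Y : Op N) : inner ℂ (hs X) (hs Y) = Matrix.trace (Xᴴ * Y) / 2 ^ N := by
  have h2 : (((√(2 ^ N))⁻¹ : ℝ) : ℂ) * (((√(2 ^ N))⁻¹ : ℝ) : ℂ) = (2 ^ N)⁻¹ := by
    rw [← Complex.ofReal_mul, ← mul_inv, Real.mul_self_sqrt (by positivity)]; push_cast; rfl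
  simp only [hs, LinearMap.coe_mk, AddHom.coe_mk]
  rw [inner_smul_left, inner_smul_right, Complex.conj_ofReal, ← mul_assoc, h2, div_eq_inv_mul]
  congr 1
  rw [PiLp.inner_apply, Fintype.sum_prod_type, Finset.sum_comm, Matrix.trace]
  refine Finset.sum_congr rfl fun i _ => ?_
  rw [Matrix.diag_apply, Matrix.mul_apply]
  refine Finset.sum_congr rfl fun j _ => ?_
  simp [mul_comm]

lemma norm_hs_sq (X : Op N) : ‖hs X‖ ^ 2 = (Matrix.trace (Xᴴ * X)).re / 2 ^ N := by
  rw [@norm_sq_eq_re_inner ℂ, inner_hs]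
  have : (2 : ℂ) ^ N = ((2 ^ N : ℝ) : ℂ) := by push_cast; rfl
  rw [this]
  exact Complex.div_ofReal_re _ _

lemma frob_eq_norm_hs (X : Op N) : frob X = ‖hs X‖ := by
  rw [frob, Matrix.trace_mul_comm, ← norm_hs_sq, Real.sqrt_sq (norm_nonneg _)]

lemma inner_hs_mul_left (A X Y : Op N) :
    inner ℂ (hs (A * X)) (hs Y) = inner ℂ (hs X) (hs (Aᴴ * Y)) := by
  rw [inner_hs, inner_hs, Matrix.conjTranspose_mul, mul_assoc]

lemma inner_hs_mul_right (A X Y : Op N) :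
    inner ℂ (hs (X * A)) (hs Y) = inner ℂ (hs X) (hs (Y * Aᴴ)) := by
  rw [inner_hs, inner_hs, Matrix.conjTranspose_mul, mul_assoc, Matrix.trace_mul_comm, mul_assoc]

lemma norm_hs_mul_of_mem_unitary {U : Op N} (hU : U ∈ unitary (Op N)) (X : Op N) :
    ‖hs (U * X)‖ = ‖hs X‖ := by
  rw [@norm_eq_sqrt_re_inner ℂ, @norm_eq_sqrt_re_inner ℂ, inner_hs_mul_left, ← mul_assoc,
    ← Matrix.star_eq_conjTranspose, (Unitary.mem_iff.1 hU).1, one_mul]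

lemma norm_hs_mul_of_mem_unitary' {U : Op N} (hU : U ∈ unitary (Op N)) (X : Op N) :
    ‖hs (X * U)‖ = ‖hs X‖ := by
  rw [@norm_eq_sqrt_re_inner ℂ, @norm_eq_sqrt_re_inner ℂ, inner_hs_mul_right, mul_assoc,
    ← Matrix.star_eq_conjTranspose, (Unitary.mem_iff.1 hU).2, mul_one]

lemma inner_siteReflection (D : Dissipation) (k : Fin N) (X Y : Op N) :
    inner ℂ (hs (siteReflection D k X)) (hs Y) = inner ℂ (hs X) (hs (siteReflection D k Y)) := by
  have key : ∀ α, inner ℂ (hs (sigma k α * X * sigma k α)) (hs Y) =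
      inner ℂ (hs X) (hs (sigma k α * Y * sigma k α)) := fun α => by
    rw [inner_hs_mul_right, inner_hs_mul_left, sigma_conjTranspose, mul_assoc]
  cases D
  · exact key .z
  · simp only [siteReflection, map_smul, map_sub, map_add, inner_smul_left, inner_smul_right,
      inner_sub_left, inner_sub_right, inner_add_left, inner_add_right, key, map_div₀, map_one, map_ofNat]

lemma norm_hs_siteReflection (D : Dissipation) (k : Fin N) (X : Op N) :
    ‖hs (siteReflection D k X)‖ = ‖hs X‖ := by
  rw [@norm_eq_sqrt_re_inner ℂ, @norm_eq_sqrt_re_inner ℂ, inner_siteReflection,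
    siteReflection_involutive]

lemma norm_entry_le_opNorm (M : Op N) (i j : Spins N) : ‖M i j‖ ≤ ‖M‖ := by
  have h1 := Matrix.l2_opNorm_mulVec M (EuclideanSpace.single j (1 : ℂ))
  rw [PiLp.norm_single, norm_one, mul_one] at h1
  have h2 := PiLp.norm_apply_le ((EuclideanSpace.equiv (Spins N) ℂ).symm
    (M *ᵥ (EuclideanSpace.single j (1 : ℂ)).ofLp)) i
  refine le_trans (le_of_eq ?_) (h2.trans h1)
  simp

/-- The Lieb-Robinson bound is stated in operator norm, while the dynamics is compared in
Hilbert-Schmidt norm; this is the bridge. -/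
lemma norm_hs_le (X : Op N) : ‖hs X‖ ≤ ‖X‖ := by
  refine le_of_sq_le_sq ?_ (norm_nonneg _)
  rw [norm_hs_sq, div_le_iff₀ (by positivity), pow_two, ← Matrix.l2_opNorm_conjTranspose_mul_self]
  calc (Matrix.trace (Xᴴ * X)).re ≤ ‖Matrix.trace (Xᴴ * X)‖ := Complex.re_le_norm _
    _ ≤ ∑ i : Spins N, ‖(Xᴴ * X) i i‖ := norm_sum_le _ _
    _ ≤ ∑ _i : Spins N, ‖Xᴴ * X‖ := Finset.sum_le_sum fun i _ => norm_entry_le_opNorm _ i i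
    _ = ‖Xᴴ * X‖ * 2 ^ N := by simp [mul_comm]

/-- The Hamiltonian part is skew-adjoint, so it contributes nothing to the radial velocity of X. -/
lemma re_inner_comm (H X : Op N) (hH : Hᴴ = H) :
    (inner ℂ (hs X) (hs ((-Complex.I) • comm H X))).re = 0 := by
  have h1 : (inner ℂ (hs X) (hs (H * X))).im = 0 := by
    have := inner_conj_symm (𝕜 := ℂ) (hs X) (hs (H * X))
    rw [inner_hs_mul_left, hH] at this
    exact Complex.conj_eq_iff_im.1 this
  have h2 : (inner ℂ (hs X) (hs (X * H))).im = 0 := by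
    have := inner_conj_symm (𝕜 := ℂ) (hs X) (hs (X * H))
    rw [inner_hs_mul_right, hH] at this
    exact Complex.conj_eq_iff_im.1 this
  rw [comm, map_smul, map_sub, inner_smul_right, inner_sub_right]
  simp [h1, h2]

end HilbertSchmidt

/-! ### The dissipative evolution: hermiticity, invertibility, differential equation. -/

section ForwardMap

variable {N : ℕ} (D : Dissipation) (g h Γ : ℝ)

lemma liouvillian_conjTranspose (X : Op N) :
    (liouvillian (isingH N g h) Γ (chainJumps N D) X)ᴴ =
      liouvillian (isingH N g h) Γ (chainJumps N D) Xᴴ := by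
  have h1 : (comm (isingH N g h) X)ᴴ = -comm (isingH N g h) Xᴴ := by
    simp [comm, isingH_isHermitian]
  rw [liouvillian_apply, liouvillian_apply, Matrix.conjTranspose_add, Matrix.conjTranspose_smul,
    Matrix.conjTranspose_smul, Matrix.conjTranspose_sum, h1]
  simp [siteReflection_conjTranspose]

lemma exp_conjTranspose_apply (T : SuperOp N) (hT : ∀ X, (T X)ᴴ = T Xᴴ) (X : Op N) :
    (NormedSpace.exp T X)ᴴ = NormedSpace.exp T Xᴴ := by
  have hpow : ∀ (n : ℕ) (X : Op N), ((T ^ n) X)ᴴ = (T ^ n) Xᴴ := by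
    intro n
    induction n with
    | zero => intro X; rfl
    | succ n ih => intro X; rw [pow_succ']; exact (hT _).trans (congrArg T (ih X))
  have h1 := NormedSpace.exp_series_hasSum_exp' (𝕂 := ℂ) T
  have h2 := ((ContinuousLinearMap.apply ℂ (Op N) X).hasSum h1).matrix_conjTranspose
  have h3 := (ContinuousLinearMap.apply ℂ (Op N) Xᴴ).hasSum h1
  have h4 : ∀ n : ℕ, (ContinuousLinearMap.apply ℂ (Op N) X ((n.factorial : ℂ)⁻¹ • T ^ n))ᴴ =
      ContinuousLinearMap.apply ℂ (Op N) Xᴴ ((n.factorial : ℂ)⁻¹ • T ^ n) := fun n => by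
    change (((n.factorial : ℂ)⁻¹) • (T ^ n) X)ᴴ = ((n.factorial : ℂ)⁻¹) • (T ^ n) Xᴴ
    rw [Matrix.conjTranspose_smul, hpow]
    simp
  simp only [h4] at h2
  exact h2.unique h3

lemma forwardMap_conjTranspose (t : ℝ) (X : Op N) :
    (forwardMap N D g h Γ t X)ᴴ = forwardMap N D g h Γ t Xᴴ := by
  refine exp_conjTranspose_apply _ (fun X => ?_) X
  simp [liouvillian_conjTranspose]

/-- An exponential is invertible. This is what keeps the denominator F(t,I,B) nonzero at every time,
however strong the damping. -/
lemma forwardMap_injective (t : ℝ) : Function.Injective (forwardMap N D g h Γ t) := by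
  let _ : NormedAlgebra ℚ (SuperOp N) := NormedAlgebra.restrictScalars ℚ ℂ (SuperOp N)
  obtain ⟨V, hV⟩ := (NormedSpace.isUnit_exp
    ((t : ℂ) • liouvillian (isingH N g h) Γ (chainJumps N D))).exists_left_inv
  intro X Y hXY
  have := congrArg V hXY
  have h2 : ∀ X, V (forwardMap N D g h Γ t X) = X := fun X => congrArg (fun T : SuperOp N => T X) hV
  rwa [h2, h2] at this

lemma forwardMap_zero (X : Op N) : forwardMap N D g h Γ 0 X = X := by
  have h0 : (0 : ℂ) • liouvillian (isingH N g h) Γ (chainJumps N D) = 0 :=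
    ContinuousLinearMap.ext fun Y => zero_smul ℂ _
  rw [forwardMap, Complex.ofReal_zero, h0, NormedSpace.exp_zero]
  rfl

lemma hasDerivAt_exp_ofReal_smul {𝔸 : Type*} [NormedRing 𝔸] [NormedAlgebra ℂ 𝔸] [CompleteSpace 𝔸]
    (x : 𝔸) (t : ℝ) :
    HasDerivAt (fun t : ℝ => NormedSpace.exp ((t : ℂ) • x))
      (x * NormedSpace.exp ((t : ℂ) • x)) t := by
  have h1 := hasDerivAt_exp_smul_const' (𝕂 := ℂ) x (t : ℂ)
  exact (h1.scomp t (Complex.ofRealCLM.hasDerivAt (x := t))).congr_deriv (by simp)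

lemma hasDerivAt_forwardMap (t : ℝ) (X : Op N) :
    HasDerivAt (fun t : ℝ => forwardMap N D g h Γ t X)
      (liouvillian (isingH N g h) Γ (chainJumps N D) (forwardMap N D g h Γ t X)) t := by
  have h2 := hasDerivAt_exp_ofReal_smul (liouvillian (isingH N g h) Γ (chainJumps N D)) t
  exact ((ContinuousLinearMap.apply ℂ (Op N) X).restrictScalars ℝ).hasFDerivAt.comp_hasDerivAt t h2

end ForwardMap

/-! ### The OTOC as an inner product and as a commutator norm. -/

section Otoc

variable {N : ℕ}

open scoped ComplexOrder in
lemma hs_injective : Function.Injective (hs (N := N)) := by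
  refine (injective_iff_map_eq_zero _).2 fun X hX => ?_
  have h1 := inner_hs X X
  rw [hX, inner_zero_left, eq_comm, div_eq_zero_iff] at h1
  have h2 := h1.resolve_right (pow_ne_zero _ two_ne_zero)
  exact Matrix.trace_conjTranspose_mul_self_eq_zero_iff.1 h2

lemma re_div_two_pow (z : ℂ) (N : ℕ) : (z / 2 ^ N).re = z.re / 2 ^ N := by
  have : (2 : ℂ) ^ N = ((2 ^ N : ℝ) : ℂ) := by push_cast; rfl
  rw [this]
  exact Complex.div_ofReal_re _ _

/-- Expand ‖XA - AX‖²: multiplication by the unitary A preserves the norm, and the cross term is the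
OTOC. -/
lemma norm_hs_comm_sq (X : Op N) (i : Fin N) (α : Axis) :
    ‖hs (comm X (sigma i α))‖ ^ 2 =
      2 * ‖hs X‖ ^ 2 - 2 * (inner ℂ (hs X) (hs (sigma i α * X * sigma i α))).re := by
  rw [comm, map_sub, @norm_sub_sq ℂ, norm_hs_mul_of_mem_unitary (sigma_mem_unitary i α),
    norm_hs_mul_of_mem_unitary' (sigma_mem_unitary i α), inner_hs_mul_right, sigma_conjTranspose]
  simp only [RCLike.re_to_complex]
  ring

lemma norm_hs_comm_le (X : Op N) (i : Fin N) (α : Axis) :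
    ‖hs (comm X (sigma i α))‖ ≤ 2 * ‖hs X‖ := by
  rw [comm, map_sub]
  refine (norm_sub_le _ _).trans ?_
  rw [norm_hs_mul_of_mem_unitary (sigma_mem_unitary i α),
    norm_hs_mul_of_mem_unitary' (sigma_mem_unitary i α)]
  linarith

lemma closedOtoc_eq (g h t : ℝ) (i j : Fin N) (α β : Axis) :
    closedOtoc N g h t (sigma i α) (sigma j β) =
      (inner ℂ (hs (closedEvolution N g h t (sigma j β)))
        (hs (sigma i α * closedEvolution N g h t (sigma j β) * sigma i α))).re := by
  rw [closedOtoc, inner_hs, re_div_two_pow, sigma_conjTranspose]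
  have key : ∀ A X Y : Op N, Matrix.trace (A * X * A * Y) = Matrix.trace (X * (A * Y * A)) :=
    fun A X Y => by
      rw [mul_assoc, mul_assoc, Matrix.trace_mul_comm A, mul_assoc]
  rw [key]

lemma otoc_eq (D : Dissipation) (g h Γ t : ℝ) {A : Op N} (hA : Aᴴ = A) (j : Fin N) (β : Axis) :
    otoc N D g h Γ t A (sigma j β) =
      (inner ℂ (hs (forwardMap N D g h Γ t (sigma j β)))
        (hs (A * forwardMap N D g h Γ t (sigma j β) * A))).re := by
  rw [otoc, inner_hs, backwardAdjointMap_eq_forwardMap, sigma_conjTranspose, hA, mul_smul_comm,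
    mul_one, map_smul, forwardMap_conjTranspose, sigma_conjTranspose, div_eq_inv_mul]
  simp only [mul_smul_comm, smul_mul_assoc, Matrix.trace_smul, smul_eq_mul, mul_assoc]

lemma otoc_one (D : Dissipation) (g h Γ t : ℝ) (j : Fin N) (β : Axis) :
    otoc N D g h Γ t 1 (sigma j β) = ‖hs (forwardMap N D g h Γ t (sigma j β))‖ ^ 2 := by
  rw [otoc_eq D g h Γ t Matrix.conjTranspose_one, one_mul, mul_one, @norm_sq_eq_re_inner ℂ]
  rfl

lemma norm_hs_sigma (j : Fin N) (β : Axis) : ‖hs (sigma j β)‖ = 1 := by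
  rw [← sq_eq_sq₀ (norm_nonneg _) zero_le_one, norm_hs_sq, sigma_conjTranspose, sigma_mul_self, ← re_div_two_pow]
  simp

lemma norm_hs_forwardMap_pos (D : Dissipation) (g h Γ t : ℝ) (j : Fin N) (β : Axis) :
    0 < ‖hs (forwardMap N D g h Γ t (sigma j β))‖ := by
  rw [norm_pos_iff]
  intro h0
  have h1 := forwardMap_injective D g h Γ t
    ((hs_injective (h0.trans (map_zero hs).symm)).trans (map_zero _).symm)
  have h2 := norm_hs_sigma j β
  rw [h1, map_zero, norm_zero] at h2
  exact zero_ne_one h2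

lemma otoc_one_pos (D : Dissipation) (g h Γ t : ℝ) (j : Fin N) (β : Axis) :
    0 < otoc N D g h Γ t 1 (sigma j β) := by
  rw [otoc_one]
  have := norm_hs_forwardMap_pos D g h Γ t j β
  positivity

lemma correctedOtoc_eq (D : Dissipation) (g h Γ t : ℝ) (i j : Fin N) (α β : Axis) :
    2 * (1 - correctedOtoc N D g h Γ t (sigma i α) (sigma j β)) =
      ‖hs (comm (forwardMap N D g h Γ t (sigma j β)) (sigma i α))‖ ^ 2 /
        ‖hs (forwardMap N D g h Γ t (sigma j β))‖ ^ 2 := by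
  have := (norm_hs_forwardMap_pos D g h Γ t j β).ne'
  rw [correctedOtoc, otoc_one, otoc_eq _ _ _ _ _ (sigma_conjTranspose i α), norm_hs_comm_sq]
  field_simp

lemma correctedSignal_eq (D : Dissipation) (g h Γ t : ℝ) (i j : Fin N) (α β : Axis) :
    correctedSignal N D g h Γ t (sigma i α) (sigma j β) =
      ‖hs (comm (forwardMap N D g h Γ t (sigma j β)) (sigma i α))‖ /
        ‖hs (forwardMap N D g h Γ t (sigma j β))‖ := by
  rw [correctedSignal, correctedOtoc_eq, ← div_pow, Real.sqrt_sq (by positivity)]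

end Otoc

/-! ### A radial growth estimate. -/

section Growth

/-- A vector whose radial velocity is bounded by `φ'` grows at most as `φ`. -/
lemma norm_le_of_inner_deriv_le {E : Type*} [NormedAddCommGroup E] [InnerProductSpace ℝ E]
    {u u' : ℝ → E} {φ φ' : ℝ → ℝ} {T : ℝ} (hT : 0 ≤ T) (hu : ∀ s, HasDerivAt u (u' s) s)
    (hφ : ∀ s, HasDerivAt φ (φ' s) s) (hφ0 : ∀ s, 0 ≤ s → φ 0 ≤ φ s)
    (hinner : ∀ s, 0 ≤ s → s ≤ T → inner ℝ (u s) (u' s) ≤ ‖u s‖ * φ' s) :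
    ‖u T‖ ≤ ‖u 0‖ + φ T - φ 0 := by
  -- The norm need not be differentiable at zero, so squared norms are compared. The slack η makes
  -- the barrier positive and the derivative inequality strict, and tends to 0 at the end.
  have key : ∀ η : ℝ, 0 < η → ‖u T‖ ≤ ‖u 0‖ + φ T - φ 0 + η * (1 + T) := by
    intro η hη
    have hG : ∀ s, HasDerivAt (fun s => ‖u 0‖ + φ s - φ 0 + η * (1 + s)) (φ' s + η) s := fun s => by
      have h1 := (((hφ s).const_add ‖u 0‖).sub_const (φ 0)).add
        (((hasDerivAt_id s).const_add 1).const_mul η)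
      exact (h1.congr_deriv (by simp))
    have hG0 : ∀ s, 0 ≤ s → 0 < ‖u 0‖ + φ s - φ 0 + η * (1 + s) := fun s hs => by
      have h1 := hφ0 s hs
      have h2 := norm_nonneg (u 0)
      have h3 : 0 < η * (1 + s) := by positivity
      linarith
    have h1 := image_le_of_deriv_right_lt_deriv_boundary (f := fun s => ‖u s‖ ^ 2)
      (f' := fun s => 2 * inner ℝ (u s) (u' s)) (a := 0) (b := T)
      (B := fun s => (‖u 0‖ + φ s - φ 0 + η * (1 + s)) ^ 2)
      (B' := fun s => 2 * (‖u 0‖ + φ s - φ 0 + η * (1 + s)) * (φ' s + η))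
      (fun s _ => (hu s).norm_sq.continuousAt.continuousWithinAt)
      (fun s _ => (hu s).norm_sq.hasDerivWithinAt)
      (by
        have : ‖u 0‖ ≤ ‖u 0‖ + φ 0 - φ 0 + η * (1 + 0) := by linarith
        exact pow_le_pow_left₀ (norm_nonneg _) this 2)
      (fun s => ((hG s).pow 2).congr_deriv (by simp))
      (by
        intro s hs heq
        have h2 : ‖u s‖ = ‖u 0‖ + φ s - φ 0 + η * (1 + s) :=
          (sq_eq_sq₀ (norm_nonneg _) (hG0 s hs.1).le).1 heq
        have h3 := hinner s hs.1 hs.2.le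
        have h4 := hG0 s hs.1
        rw [← h2] at h4 ⊢
        nlinarith [mul_pos h4 hη])
    exact le_of_sq_le_sq (h1 ⟨hT, le_rfl⟩) (hG0 T hT).le
  refine le_of_forall_pos_le_add fun δ hδ => ?_
  have h1 := key (δ / (1 + T)) (by positivity)
  rwa [div_mul_cancel₀ _ (by positivity)] at h1

end Growth

/-! ### Existence of a Lieb-Robinson velocity. -/

section LiebRobinson

instance : Fintype Axis :=
  ⟨⟨([.x, .y, .z] : List Axis), by simp⟩, by rintro ⟨⟩ <;> simp⟩

variable {N : ℕ}

lemma norm_comm_mul_left_le (X Y Z : Op N) :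
    ‖comm (X * Y) Z‖ ≤ ‖X‖ * ‖comm Y Z‖ + ‖comm X Z‖ * ‖Y‖ := by
  rw [comm_mul_left]
  exact (norm_add_le _ _).trans (add_le_add (norm_mul_le _ _) (norm_mul_le _ _))

lemma comm_sigma_of_ne {k i : Fin N} (hki : k ≠ i) (α β : Axis) :
    comm (sigma k α) (sigma i β) = 0 := sub_eq_zero.2 (sigma_commute hki α β).eq

/-- The commutator of `B` with a bond term of `[H, σ^α_i]` is controlled by commutators with Pauli
operators on neighbouring sites. -/
lemma norm_comm_bond_le (g h t : ℝ) (B : Op N) (i k l : Fin N) (hkl : (k : ℕ) + 1 = l) (α : Axis)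
    {M : ℝ} (hM : ∀ (k : Fin N) γ, |((k : ℕ) : ℝ) - ((i : ℕ) : ℝ)| ≤ 1 →
      ‖comm (closedEvolution N g h t (sigma k γ)) B‖ ≤ M) :
    ‖comm (closedEvolution N g h t (comm (sigma k .z * sigma l .z) (sigma i α))) B‖ ≤
      (if k = i then 4 * M else 0) + (if l = i then 4 * M else 0) := by
  have hk : k ≠ l := fun e => by subst e; omega
  have hcast : ((l : ℕ) : ℝ) = ((k : ℕ) : ℝ) + 1 := by rw [← hkl]; push_cast; rfl
  have hprod : ∀ (z : ℂ) (m n : Fin N) (γ δ : Axis), ‖z‖ ≤ 2 →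
      |((m : ℕ) : ℝ) - ((i : ℕ) : ℝ)| ≤ 1 → |((n : ℕ) : ℝ) - ((i : ℕ) : ℝ)| ≤ 1 →
      ‖comm (closedEvolution N g h t (z • (sigma m γ * sigma n δ))) B‖ ≤ 4 * M := by
    intro z m n γ δ hz hm hn
    have h1 := norm_comm_mul_left_le (closedEvolution N g h t (sigma m γ))
      (closedEvolution N g h t (sigma n δ)) B
    rw [norm_closedEvolution, norm_closedEvolution, norm_sigma, norm_sigma] at h1
    have h2 := hM m γ hm
    have h3 := hM n δ hn
    rw [closedEvolution_smul, closedEvolution_mul, comm_smul_left, norm_smul]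
    calc _ ≤ 2 * (2 * M) := mul_le_mul hz (by linarith) (norm_nonneg _) (by norm_num)
      _ = 4 * M := by ring
  by_cases hki : k = i
  · subst hki
    rw [if_pos rfl, if_neg hk.symm, add_zero, comm_mul_left, comm_sigma_of_ne hk.symm, mul_zero,
      zero_add]
    obtain ⟨z, γ, hz, e⟩ := sigma_comm_same k .z α
    rw [e, smul_mul_assoc]
    exact hprod z k l γ .z hz (by simp) (by rw [hcast]; simp)
  · by_cases hli : l = i
    · subst hli
      rw [if_pos rfl, if_neg hki, zero_add, comm_mul_left, comm_sigma_of_ne hk, zero_mul, add_zero]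
      obtain ⟨z, γ, hz, e⟩ := sigma_comm_same l .z α
      rw [e, mul_smul_comm]
      exact hprod z k l .z γ hz (by rw [hcast]; simp) (by simp)
    · rw [comm_mul_left, comm_sigma_of_ne hki, comm_sigma_of_ne hli, if_neg hki, if_neg hli]
      simp [closedEvolution, comm]

lemma norm_comm_field_le (g h t : ℝ) (B : Op N) (i k : Fin N) (α β : Axis)
    {M : ℝ} (hM : ∀ γ, ‖comm (closedEvolution N g h t (sigma i γ)) B‖ ≤ M) :
    ‖comm (closedEvolution N g h t (comm (sigma k β) (sigma i α))) B‖ ≤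
      if k = i then 2 * M else 0 := by
  by_cases hki : k = i
  · subst hki
    rw [if_pos rfl]
    obtain ⟨z, γ, hz, e⟩ := sigma_comm_same k β α
    rw [e, closedEvolution_smul, comm_smul_left, norm_smul]
    exact mul_le_mul hz (hM γ) (norm_nonneg _) (by norm_num)
  · rw [comm_sigma_of_ne hki, if_neg hki]
    simp [closedEvolution, comm]

/-- A site of the open chain belongs to at most two bonds. -/
lemma sum_bond_le (i : Fin N) {c : ℝ} (hc : 0 ≤ c) :
    ∑ k : Fin N, ∑ l : Fin N, (if (k : ℕ) + 1 = l then
      (if k = i then c else 0) + (if l = i then c else 0) else 0) ≤ 2 * c := by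
  have h1 : ∀ k l : Fin N, (if (k : ℕ) + 1 = l then
      (if k = i then c else 0) + (if l = i then c else 0) else 0) =
      (if k = i then (if (k : ℕ) + 1 = l then c else 0) else 0) +
      (if l = i then (if (k : ℕ) + 1 = l then c else 0) else 0) := fun k l => by
    split_ifs <;> simp
  have h2 : ∑ l : Fin N, (if (i : ℕ) + 1 = l then c else 0) ≤ c := by
    rw [← Finset.sum_filter, Finset.sum_const, nsmul_eq_mul]
    have : (Finset.univ.filter fun l : Fin N => (i : ℕ) + 1 = l).card ≤ 1 :=
      Finset.card_le_one.2 fun a ha b hb => Fin.ext (by simp at ha hb; omega)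
    have : ((Finset.univ.filter fun l : Fin N => (i : ℕ) + 1 = l).card : ℝ) ≤ 1 := by
      exact_mod_cast this
    nlinarith
  have h3 : ∑ k : Fin N, (if (k : ℕ) + 1 = i then c else 0) ≤ c := by
    rw [← Finset.sum_filter, Finset.sum_const, nsmul_eq_mul]
    have : (Finset.univ.filter fun k : Fin N => (k : ℕ) + 1 = i).card ≤ 1 :=
      Finset.card_le_one.2 fun a ha b hb => Fin.ext (by simp at ha hb; omega)
    have : ((Finset.univ.filter fun k : Fin N => (k : ℕ) + 1 = i).card : ℝ) ≤ 1 := by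
      exact_mod_cast this
    nlinarith
  simp only [h1, Finset.sum_add_distrib]
  have h4 : ∑ k : Fin N, ∑ l : Fin N, (if k = i then (if (k : ℕ) + 1 = l then c else 0) else 0) =
      ∑ l : Fin N, (if (i : ℕ) + 1 = l then c else 0) := by
    rw [Finset.sum_comm]
    simp
  have h5 : ∑ k : Fin N, ∑ l : Fin N, (if l = i then (if (k : ℕ) + 1 = l then c else 0) else 0) =
      ∑ k : Fin N, (if (k : ℕ) + 1 = i then c else 0) := by
    simp
  rw [h4, h5]
  linarith

lemma norm_comm_isingH_le (g h t : ℝ) (B : Op N) (i : Fin N) (α : Axis) {M : ℝ} (hM0 : 0 ≤ M)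
    (hM : ∀ (k : Fin N) γ, |((k : ℕ) : ℝ) - ((i : ℕ) : ℝ)| ≤ 1 →
      ‖comm (closedEvolution N g h t (sigma k γ)) B‖ ≤ M) :
    ‖comm (closedEvolution N g h t (comm (isingH N g h) (sigma i α))) B‖ ≤
      (8 + 2 * |g| + 2 * |h|) * M := by
  let Φ : Op N →ₗ[ℂ] Op N :=
    { toFun := fun X => comm (closedEvolution N g h t (comm X (sigma i α))) B
      map_add' := fun X Y => by
        simp only [comm_add_left, closedEvolution_add]
      map_smul' := fun c X => by
        simp only [comm_smul_left, closedEvolution_smul, RingHom.id_apply] }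
  change ‖Φ (isingH N g h)‖ ≤ _
  have hbond : ‖Φ (∑ k : Fin N, ∑ l : Fin N,
      if (k : ℕ) + 1 = l then sigma k .z * sigma l .z else 0)‖ ≤ 2 * (4 * M) := by
    rw [map_sum]
    refine (norm_sum_le _ _).trans (le_trans (Finset.sum_le_sum fun k _ => ?_)
      (sum_bond_le i (by positivity : 0 ≤ 4 * M)))
    rw [map_sum]
    refine (norm_sum_le _ _).trans (Finset.sum_le_sum fun l _ => ?_)
    split_ifs with hkl
    all_goals first
      | (rw [map_zero, norm_zero])
      | skip
    all_goals
      have := norm_comm_bond_le g h t B i k l hkl α hM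
      simp_all [Φ]
  have hfield : ‖Φ (∑ k : Fin N, ((g : ℂ) • sigma k .x + (h : ℂ) • sigma k .z))‖ ≤
      (|g| + |h|) * (2 * M) := by
    have hM' : ∀ γ, ‖comm (closedEvolution N g h t (sigma i γ)) B‖ ≤ M :=
      fun γ => hM i γ (by simp)
    rw [map_sum]
    calc _ ≤ ∑ k : Fin N, (if k = i then (|g| + |h|) * (2 * M) else 0) := by
          refine (norm_sum_le _ _).trans (Finset.sum_le_sum fun k _ => ?_)
          rw [map_add, map_smul, map_smul]
          refine (norm_add_le _ _).trans ?_
          rw [norm_smul, norm_smul, Complex.norm_real, Complex.norm_real, Real.norm_eq_abs,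
            Real.norm_eq_abs]
          have hx := mul_le_mul_of_nonneg_left (norm_comm_field_le g h t B i k α .x hM')
            (abs_nonneg g)
          have hz := mul_le_mul_of_nonneg_left (norm_comm_field_le g h t B i k α .z hM')
            (abs_nonneg h)
          refine (add_le_add hx hz).trans (le_of_eq ?_)
          split_ifs <;> ring
      _ = _ := by simp
  rw [isingH, map_sub, map_neg]
  refine (norm_sub_le _ _).trans ?_
  rw [norm_neg]
  linarith

/-- The Lieb-Robinson bound for Pauli operators and the evolution under `+H`. -/
lemma norm_comm_closedEvolution_sigma_le (g h : ℝ) (j : Fin N) {B : Op N}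
    (hB : ∀ k γ, k ≠ j → comm (sigma k γ) B = 0) (i : Fin N) (α : Axis) {t : ℝ} (ht : 0 ≤ t) :
    ‖comm (closedEvolution N g h (-t) (sigma i α)) B‖ ≤
      2 * ‖B‖ * Real.exp ((8 + 2 * |g| + 2 * |h|) * Real.exp 1 * t -
        |((i : ℕ) : ℝ) - ((j : ℕ) : ℝ)|) := by
  set K := (8 + 2 * |g| + 2 * |h|) * Real.exp 1 with hK
  -- Exponential weights turn the hierarchy of neighbour-coupled inequalities into one Gronwall
  -- inequality in the weighted sup norm: moving to a neighbour costs at most a factor e. Undoing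
  -- the weight at the end produces the spatial decay.
  let w : Fin N → ℝ := fun k => Real.exp |((k : ℕ) : ℝ) - ((j : ℕ) : ℝ)|
  have hw : ∀ k, 0 < w k := fun k => Real.exp_pos _
  let f : ℝ → (Fin N × Axis → Op N) := fun s p =>
    w p.1 • comm (closedEvolution N g h (-s) (sigma p.1 p.2)) B
  let f' : ℝ → (Fin N × Axis → Op N) := fun s p =>
    w p.1 • comm (Complex.I • closedEvolution N g h (-s) (comm (isingH N g h) (sigma p.1 p.2))) B
  have hderiv : ∀ s, HasDerivAt f (f' s) s := by
    intro s
    rw [hasDerivAt_pi]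
    intro p
    have h1 := (hasDerivAt_closedEvolution g h (-s) (sigma p.1 p.2)).scomp s (hasDerivAt_neg s)
    have h2 := ((h1.mul_const B).sub (h1.const_mul B)).const_smul (w p.1)
    have e : ∀ X : Op N, (-1 : ℝ) • (-Complex.I) • X = Complex.I • X := fun X => by simp
    refine h2.congr_deriv ?_
    -- H is invariant under its own flow, so the derivative is the evolved local commutator [H, σ].
    simp only [f', closedEvolution_comm, closedEvolution_isingH, e]
    rfl
  have hcomp : ∀ s k γ, ‖comm (closedEvolution N g h (-s) (sigma k γ)) B‖ ≤ (w k)⁻¹ * ‖f s‖ := by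
    intro s k γ
    have h1 := norm_le_pi_norm (f s) (k, γ)
    simp only [f, norm_smul, Real.norm_eq_abs, abs_of_pos (hw k)] at h1
    rw [inv_mul_eq_div, le_div_iff₀ (hw k), mul_comm]
    exact h1
  have hbound : ∀ s, ‖f' s‖ ≤ K * ‖f s‖ + 0 := by
    intro s
    rw [add_zero, pi_norm_le_iff_of_nonneg (by positivity)]
    rintro ⟨k, γ⟩
    have h1 := norm_comm_isingH_le g h (-s) B k γ
      (M := Real.exp 1 * ((w k)⁻¹ * ‖f s‖)) (by have := hw k; positivity) (by
        intro l δ hl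
        refine (hcomp s l δ).trans ?_
        rw [← mul_assoc]
        refine mul_le_mul_of_nonneg_right ?_ (norm_nonneg _)
        simp only [w]
        rw [← Real.exp_neg, ← Real.exp_neg, ← Real.exp_add, Real.exp_le_exp]
        have := abs_sub_le ((k : ℕ) : ℝ) ((l : ℕ) : ℝ) ((j : ℕ) : ℝ)
        rw [abs_sub_comm] at hl
        linarith)
    simp only [f', comm_smul_left, norm_smul, Real.norm_eq_abs, abs_of_pos (hw k),
      Complex.norm_I, one_mul]
    calc _ ≤ w k * ((8 + 2 * |g| + 2 * |h|) * (Real.exp 1 * ((w k)⁻¹ * ‖f s‖))) :=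
          mul_le_mul_of_nonneg_left h1 (hw k).le
      _ = (w k * (w k)⁻¹) * (K * ‖f s‖) := by rw [hK]; ring
      _ = K * ‖f s‖ := by rw [mul_inv_cancel₀ (hw k).ne', one_mul]
  have hzero : ‖f 0‖ ≤ 2 * ‖B‖ := by
    rw [pi_norm_le_iff_of_nonneg (by positivity)]
    rintro ⟨k, γ⟩
    simp only [f, neg_zero, closedEvolution_zero]
    by_cases hk : k = j
    · subst hk
      have := norm_comm_le (sigma k γ) B
      rw [norm_sigma] at this
      simp only [w, sub_self, abs_zero, Real.exp_zero, one_smul]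
      linarith
    · rw [hB k γ hk, smul_zero, norm_zero]
      positivity
  have hmain := norm_le_gronwallBound_of_norm_deriv_right_le (f := f) (f' := f') (a := 0) (b := t)
    (fun s _ => (hderiv s).continuousAt.continuousWithinAt)
    (fun s _ => (hderiv s).hasDerivWithinAt) hzero (fun s _ => hbound s) t ⟨ht, le_rfl⟩
  rw [gronwallBound_ε0, sub_zero] at hmain
  refine (hcomp t i α).trans ((mul_le_mul_of_nonneg_left hmain (inv_nonneg.2 (hw i).le)).trans
    (le_of_eq ?_))
  rw [sub_eq_add_neg, Real.exp_add, Real.exp_neg]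
  ring

/-- Each coefficient is half a sum of two entries of P, up to phases, and entries are bounded by the
operator norm. -/
lemma exists_pauli_decomposition (i : Fin N) (P : Matrix (Fin 2) (Fin 2) ℂ) :
    ∃ p x y z : ℂ, ‖x‖ ≤ ‖(siteOp i P : Op N)‖ ∧ ‖y‖ ≤ ‖(siteOp i P : Op N)‖ ∧
      ‖z‖ ≤ ‖(siteOp i P : Op N)‖ ∧
      (siteOp i P : Op N) = p • (1 : Op N) + x • sigma i .x + y • sigma i .y + z • sigma i .z := by
  have hent : ∀ a b, ‖P a b‖ ≤ ‖(siteOp i P : Op N)‖ := fun a b => by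
    refine le_trans (le_of_eq ?_) (norm_entry_le_opNorm (siteOp i P : Op N)
      (Function.update 0 i a) (Function.update 0 i b))
    have : ∀ l, l ≠ i → (Function.update 0 i a : Spins N) l = (Function.update 0 i b : Spins N) l :=
      fun l hl => by rw [Function.update_of_ne hl, Function.update_of_ne hl]
    simp only [siteOp, Matrix.of_apply, if_pos this, Function.update_self]
  have half : ∀ u v : ℂ, ‖u‖ ≤ ‖(siteOp i P : Op N)‖ → ‖v‖ ≤ ‖(siteOp i P : Op N)‖ →
      ‖(u + v) / 2‖ ≤ ‖(siteOp i P : Op N)‖ := fun u v hu hv => by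
    rw [norm_div, Complex.norm_ofNat]
    have := norm_add_le u v
    linarith
  refine ⟨(P 0 0 + P 1 1) / 2, (P 0 1 + P 1 0) / 2, (Complex.I * P 0 1 + -Complex.I * P 1 0) / 2,
    (P 0 0 + -P 1 1) / 2, half _ _ (hent _ _) (hent _ _),
    half _ _ (by simpa using hent 0 1) (by simpa using hent 1 0),
    half _ _ (hent _ _) (by simpa using hent 1 1), ?_⟩
  rw [← siteOp_one i]
  simp only [sigma, ← siteOp_smul, ← siteOp_add]
  congr 1
  have hI := Complex.I_mul_I
  ext a b
  fin_cases a <;> fin_cases b <;> simp [pauli] <;> ring_nf <;> simp <;> ring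

lemma exists_isLiebRobinson (g h a : ℝ) (ha : 0 < a) :
    ∃ c ξ v : ℝ, 0 < c ∧ 0 < ξ ∧ 0 < v ∧ IsLiebRobinson g h a c ξ v := by
  -- 6 is three Pauli components times the 2 from ‖[X,Y]‖ ≤ 2‖X‖‖Y‖. The decay is e per lattice
  -- site, hence ξ = a, and v is the Gronwall rate in units of a.
  refine ⟨6, a, a * ((8 + 2 * |g| + 2 * |h|) * Real.exp 1), by norm_num, ha, by positivity, ?_⟩
  intro N i j P Q _ _ t ht
  set K := (8 + 2 * |g| + 2 * |h|) * Real.exp 1 with hK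
  set B : Op N := siteOp j Q
  set e := Real.exp (K * t - |((i : ℕ) : ℝ) - ((j : ℕ) : ℝ)|) with he
  have hexp : Real.exp (-(siteDist a i j - a * K * t) / a) = e := by
    rw [he, siteDist]
    congr 1
    field_simp
    ring
  -- The evolution is moved from B to P, where the Pauli estimate applies.
  have h1 : comm (closedEvolution N g h t B) (siteOp i P) =
      closedEvolution N g h t (comm B (closedEvolution N g h (-t) (siteOp i P))) := by
    rw [closedEvolution_comm, closedEvolution_neg_cancel]
  have hσ : ∀ α, ‖comm (closedEvolution N g h (-t) (sigma i α)) B‖ ≤ 2 * ‖B‖ * e := fun α =>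
    norm_comm_closedEvolution_sigma_le g h j
      (fun k γ hk => sub_eq_zero.2 (siteOp_commute hk _ _).eq) i α ht
  have hanti : ∀ X Y : Op N, ‖comm X Y‖ = ‖comm Y X‖ := fun X Y => norm_sub_rev _ _
  rw [h1, norm_closedEvolution, hanti, hexp]
  obtain ⟨p, x, y, z, hx, hy, hz, hP⟩ := exists_pauli_decomposition i P
  have h2 : closedEvolution N g h (-t) (siteOp i P) = p • (1 : Op N) +
      x • closedEvolution N g h (-t) (sigma i .x) + y • closedEvolution N g h (-t) (sigma i .y) +
      z • closedEvolution N g h (-t) (sigma i .z) := by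
    simp only [hP, closedEvolution_add, closedEvolution_smul, closedEvolution_one]
  have h3 : comm (1 : Op N) B = 0 := by simp [comm]
  rw [h2, comm_add_left, comm_add_left, comm_add_left, comm_smul_left, comm_smul_left,
    comm_smul_left, comm_smul_left, h3, smul_zero, zero_add]
  have hterm : ∀ (u : ℂ) (α : Axis), ‖u‖ ≤ ‖(siteOp i P : Op N)‖ →
      ‖u • comm (closedEvolution N g h (-t) (sigma i α)) B‖ ≤
        ‖(siteOp i P : Op N)‖ * (2 * ‖B‖ * e) := fun u α hu => by
    rw [norm_smul]
    exact mul_le_mul hu (hσ α) (norm_nonneg _) (norm_nonneg _)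
  refine (norm_add₃_le).trans ((add_le_add_three (hterm x .x hx) (hterm y .y hy)
    (hterm z .z hz)).trans (le_of_eq ?_))
  ring

end LiebRobinson

/-! ### Counting sites inside the cone and summing the tails outside. -/

section ConeSums

variable {N : ℕ}

lemma card_cone_le (j : Fin N) (r : ℕ) :
    (Finset.univ.filter fun k : Fin N => (k : ℕ) ≤ j + r ∧ (j : ℕ) ≤ k + r).card ≤ 2 * r + 1 := by
  have h1 : (Finset.univ.filter fun k : Fin N => (k : ℕ) ≤ j + r ∧ (j : ℕ) ≤ k + r).card ≤
      (Finset.Icc ((j : ℕ) - r) (j + r)).card := by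
    refine Finset.card_le_card_of_injOn (fun k => (k : ℕ)) (fun k hk => ?_)
      (fun a _ b _ hab => Fin.ext hab)
    simp only [Finset.coe_filter, Finset.mem_univ, true_and, Set.mem_ofPred_eq] at hk
    simp only [Finset.coe_Icc, Set.mem_Icc]
    omega
  rw [Nat.card_Icc] at h1
  omega

lemma sum_pow_le_of_injOn {ι : Type*} (s : Finset ι) (e : ι → ℕ) (he : Set.InjOn e s) {q : ℝ}
    (hq0 : 0 ≤ q) (hq1 : q < 1) : ∑ k ∈ s, q ^ e k ≤ (1 - q)⁻¹ := by
  classical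
  rw [← Finset.sum_image (f := fun n => q ^ n) he, ← tsum_geometric_of_lt_one hq0 hq1]
  exact (summable_geometric_of_lt_one hq0 hq1).sum_le_tsum _ fun n _ => pow_nonneg hq0 n

lemma inv_one_sub_exp_le {y : ℝ} (hy : 0 < y) : (1 - Real.exp (-y))⁻¹ ≤ 1 + y⁻¹ := by
  have h1 : Real.exp (-y) ≤ (1 + y)⁻¹ := by
    rw [Real.exp_neg]
    exact inv_anti₀ (by linarith) (by linarith [Real.add_one_le_exp y])
  have h2 : y / (1 + y) ≤ 1 - Real.exp (-y) := by
    have : y / (1 + y) = 1 - (1 + y)⁻¹ := by field_simp; ring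
    linarith
  calc (1 - Real.exp (-y))⁻¹ ≤ (y / (1 + y))⁻¹ := inv_anti₀ (by positivity) h2
    _ = 1 + y⁻¹ := by field_simp; ring

/-- Splitting the sites at the cone of radius `ρ`: at most `2ρ/a + 1` sites are inside, and the
exponential tails outside add up to a constant. -/
lemma sum_sites_le (j : Fin N) {a ξ ρ : ℝ} (ha : 0 < a) (hξ : 0 < ξ) (hρ : 0 ≤ ρ) :
    ∃ s : Finset (Fin N), (s.card : ℝ) ≤ 2 * ρ / a + 1 ∧
      ∑ k ∈ sᶜ, Real.exp (-(siteDist a k j - ρ) / ξ) ≤ 2 * (1 + ξ / a) := by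
  set r := ⌊ρ / a⌋₊ with hr
  have hr1 : (r : ℝ) ≤ ρ / a := Nat.floor_le (by positivity)
  have hr2 : ρ < a * (r + 1) := by
    have := Nat.lt_floor_add_one (ρ / a)
    rwa [div_lt_iff₀ ha, mul_comm] at this
  refine ⟨Finset.univ.filter fun k : Fin N => (k : ℕ) ≤ j + r ∧ (j : ℕ) ≤ k + r, ?_, ?_⟩
  · have h1 : ((Finset.univ.filter fun k : Fin N =>
        (k : ℕ) ≤ j + r ∧ (j : ℕ) ≤ k + r).card : ℝ) ≤ 2 * r + 1 := by
      exact_mod_cast card_cone_le j r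
    have h2 : 2 * ρ / a = 2 * (ρ / a) := by ring
    linarith
  · set q := Real.exp (-(a / ξ)) with hq
    have hq1 : q < 1 := by rw [hq, Real.exp_lt_one_iff]; simp; positivity
    -- The first site outside is at distance a(r + 1) > ρ, so the geometric series on each side
    -- starts with a term at most 1.
    have hterm : ∀ (k : Fin N) (n : ℕ), |((k : ℕ) : ℝ) - ((j : ℕ) : ℝ)| = r + 1 + n →
        Real.exp (-(siteDist a k j - ρ) / ξ) ≤ q ^ n := fun k n hkn => by
      rw [hq, ← Real.exp_nat_mul, Real.exp_le_exp, siteDist, hkn, div_le_iff₀ hξ]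
      have : (n : ℝ) * -(a / ξ) * ξ = -(n * a) := by field_simp
      rw [this]
      linarith
    set R := Finset.univ.filter fun k : Fin N => (j : ℕ) + r < k
    set L := Finset.univ.filter fun k : Fin N => (k : ℕ) + r < j
    have hsplit : (Finset.univ.filter fun k : Fin N => (k : ℕ) ≤ j + r ∧ (j : ℕ) ≤ k + r)ᶜ =
        R ∪ L := by
      ext k
      simp only [R, L, Finset.mem_compl, Finset.mem_filter, Finset.mem_univ, true_and,
        Finset.mem_union]
      omega
    have hR : ∑ k ∈ R, Real.exp (-(siteDist a k j - ρ) / ξ) ≤ (1 - q)⁻¹ := by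
      refine le_trans (Finset.sum_le_sum fun k hk => hterm k ((k : ℕ) - j - r - 1) ?_)
        (sum_pow_le_of_injOn R (fun k => (k : ℕ) - j - r - 1) ?_ (Real.exp_pos _).le hq1)
      · simp only [R, Finset.mem_filter, Finset.mem_univ, true_and] at hk
        obtain ⟨n, hn⟩ : ∃ n : ℕ, (k : ℕ) = j + r + 1 + n := ⟨(k : ℕ) - j - r - 1, by omega⟩
        have : (k : ℕ) - j - r - 1 = n := by omega
        rw [this, hn]
        push_cast
        rw [abs_of_nonneg (by linarith [(Nat.cast_nonneg r : (0 : ℝ) ≤ r),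
          (Nat.cast_nonneg n : (0 : ℝ) ≤ n)])]
        ring
      · intro x hx y hy hxy
        simp only [R, Finset.coe_filter, Finset.mem_univ, true_and, Set.mem_ofPred_eq] at hx hy hxy
        exact Fin.ext (by omega)
    have hL : ∑ k ∈ L, Real.exp (-(siteDist a k j - ρ) / ξ) ≤ (1 - q)⁻¹ := by
      refine le_trans (Finset.sum_le_sum fun k hk => hterm k ((j : ℕ) - k - r - 1) ?_)
        (sum_pow_le_of_injOn L (fun k => (j : ℕ) - k - r - 1) ?_ (Real.exp_pos _).le hq1)
      · simp only [L, Finset.mem_filter, Finset.mem_univ, true_and] at hk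
        obtain ⟨n, hn⟩ : ∃ n : ℕ, (j : ℕ) = k + r + 1 + n := ⟨(j : ℕ) - k - r - 1, by omega⟩
        have : (j : ℕ) - k - r - 1 = n := by omega
        rw [this, hn, abs_sub_comm]
        push_cast
        rw [abs_of_nonneg (by linarith [(Nat.cast_nonneg r : (0 : ℝ) ≤ r),
          (Nat.cast_nonneg n : (0 : ℝ) ≤ n)])]
        ring
      · intro x hx y hy hxy
        simp only [L, Finset.coe_filter, Finset.mem_univ, true_and, Set.mem_ofPred_eq] at hx hy hxy
        exact Fin.ext (by omega)
    rw [hsplit, Finset.sum_union (Finset.disjoint_left.2 fun k hk hk' => by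
      simp only [R, L, Finset.mem_filter, Finset.mem_univ, true_and] at hk hk'
      omega)]
    have h1 := inv_one_sub_exp_le (y := a / ξ) (by positivity)
    rw [inv_div] at h1
    linarith

end ConeSums

/-! ### Dissipative against closed evolution. -/

section Dissipator

variable {N : ℕ}

lemma norm_hs_sigma_conj_sub_le (k : Fin N) (α : Axis) (O : Op N) :
    ‖hs (sigma k α * O * sigma k α - O)‖ ≤ ‖comm O (sigma k α)‖ := by
  have h1 : sigma k α * O * sigma k α - O = -comm O (sigma k α) * sigma k α := by
    have h2 : O * sigma k α * sigma k α = O := by rw [mul_assoc, sigma_mul_self, mul_one]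
    rw [comm, neg_mul, sub_mul, h2, neg_sub]
  rw [h1, norm_hs_mul_of_mem_unitary' (sigma_mem_unitary k α), map_neg, norm_neg]
  exact norm_hs_le _

lemma norm_hs_siteReflection_sub_le (D : Dissipation) (k : Fin N) (O : Op N) {η : ℝ}
    (hη : ∀ α, ‖comm O (sigma k α)‖ ≤ η) : ‖hs (siteReflection D k O - O)‖ ≤ 2 * η := by
  have h0 : 0 ≤ η := (norm_nonneg _).trans (hη .x)
  have h1 : ∀ α, ‖hs (sigma k α * O * sigma k α - O)‖ ≤ η := fun α =>
    (norm_hs_sigma_conj_sub_le k α O).trans (hη α)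
  cases D
  · exact (h1 .z).trans (by linarith)
  · have h2 : siteReflection .phaseDepolarizing k O - O =
        (1 / 2 : ℂ) • ((sigma k .x * O * sigma k .x - O) + (sigma k .y * O * sigma k .y - O) +
          (sigma k .z * O * sigma k .z - O)) := by
      simp only [siteReflection]
      module
    rw [h2, map_smul, norm_smul, map_add, map_add]
    have h3 := norm_add₃_le (a := hs (sigma k .x * O * sigma k .x - O))
      (b := hs (sigma k .y * O * sigma k .y - O)) (c := hs (sigma k .z * O * sigma k .z - O))
    have h4 : ‖(1 / 2 : ℂ)‖ = 1 / 2 := by simp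
    rw [h4]
    linarith [h1 .x, h1 .y, h1 .z]

/-- Cauchy-Schwarz for an isometry: the dissipator never increases the Hilbert-Schmidt norm. -/
lemma re_inner_siteReflection_sub_nonpos (D : Dissipation) (k : Fin N) (O : Op N) :
    (inner ℂ (hs O) (hs (siteReflection D k O - O))).re ≤ 0 := by
  rw [map_sub, inner_sub_right, Complex.sub_re]
  have h1 := @re_inner_le_norm ℂ _ _ _ _ (hs O) (hs (siteReflection D k O))
  rw [norm_hs_siteReflection] at h1
  have h2 := @inner_self_eq_norm_mul_norm ℂ _ _ _ _ (hs O)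
  simp only [RCLike.re_to_complex] at h1 h2
  linarith

/-- On an operator spreading inside a cone of radius `ρ`, the dissipator acts as a damping at the
mean rate `(2 ρ / a + 1) / 2`, up to an error of the same size and the tails. -/
lemma norm_hs_sum_siteReflection_le (D : Dissipation) (j : Fin N) {a c ξ ρ : ℝ} (ha : 0 < a)
    (hc : 0 < c) (hξ : 0 < ξ) (hρ : 0 ≤ ρ) {b : Op N} (hb : ‖hs b‖ = 1)
    (hLR : ∀ k α, ‖comm b (sigma k α)‖ ≤ c * Real.exp (-(siteDist a k j - ρ) / ξ)) :
    ‖hs ((∑ k, (siteReflection D k b - b)) + ((2 * ρ / a + 1 : ℝ) : ℂ) • b)‖ ≤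
      2 * ρ / a + 1 + 4 * c * (1 + ξ / a) := by
  obtain ⟨s, hs1, hs2⟩ := sum_sites_le j ha hξ hρ
  -- Adding p b, p = 2ρ/a + 1, cancels the -b of each inside site. The remaining reflections have
  -- norm |s| and the surplus (p - |s|) b fills up to p, where `|s| ≤ p` is used; bounding each R_k
  -- b - b by 2 would give 2p.
  have h1 : (∑ k, (siteReflection D k b - b)) + ((2 * ρ / a + 1 : ℝ) : ℂ) • b =
      (∑ k ∈ s, siteReflection D k b) + (∑ k ∈ sᶜ, (siteReflection D k b - b)) +
        ((2 * ρ / a + 1 - s.card : ℝ) : ℂ) • b := by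
    rw [← Finset.sum_add_sum_compl s, Finset.sum_sub_distrib (s := s), Finset.sum_const,
      Complex.ofReal_sub, sub_smul, Complex.ofReal_natCast, Nat.cast_smul_eq_nsmul]
    abel
  rw [h1, map_add, map_add, map_sum, map_sum, map_smul]
  have h2 : ‖∑ k ∈ s, hs (siteReflection D k b)‖ ≤ s.card := by
    refine (norm_sum_le _ _).trans (le_of_eq ?_)
    simp [norm_hs_siteReflection, hb]
  have h3 : ‖∑ k ∈ sᶜ, hs (siteReflection D k b - b)‖ ≤ 4 * c * (1 + ξ / a) := by
    refine (norm_sum_le _ _).trans ?_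
    calc _ ≤ ∑ k ∈ sᶜ, 2 * c * Real.exp (-(siteDist a k j - ρ) / ξ) :=
          Finset.sum_le_sum fun k _ => by
            rw [mul_assoc]
            exact norm_hs_siteReflection_sub_le D k b (hLR k)
      _ = 2 * c * ∑ k ∈ sᶜ, Real.exp (-(siteDist a k j - ρ) / ξ) := by rw [Finset.mul_sum]
      _ ≤ 2 * c * (2 * (1 + ξ / a)) := mul_le_mul_of_nonneg_left hs2 (by positivity)
      _ = 4 * c * (1 + ξ / a) := by ring
  have h4 : ‖((2 * ρ / a + 1 - s.card : ℝ) : ℂ) • hs b‖ = 2 * ρ / a + 1 - s.card := by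
    rw [norm_smul, hb, mul_one, Complex.norm_real, Real.norm_eq_abs, abs_of_nonneg (by linarith)]
  refine (norm_add₃_le).trans ?_
  linarith

lemma norm_hs_closedEvolution_sigma (g h t : ℝ) (j : Fin N) (β : Axis) :
    ‖hs (closedEvolution N g h t (sigma j β))‖ = 1 := by
  rw [closedEvolution, norm_hs_mul_of_mem_unitary' (exp_isingH_mem_unitary g h t),
    norm_hs_mul_of_mem_unitary (exp_neg_isingH_mem_unitary g h t), norm_hs_sigma]

lemma IsLiebRobinson.norm_comm_sigma_le {g h a c ξ v : ℝ} (hLR : IsLiebRobinson g h a c ξ v)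
    {t : ℝ} (ht : 0 ≤ t) (i j : Fin N) (α β : Axis) :
    ‖comm (closedEvolution N g h t (sigma j β)) (sigma i α)‖ ≤
      c * Real.exp (-(siteDist a i j - v * t) / ξ) := by
  have h1 := hLR N i j (pauli α) (pauli β) (pauli_isHermitian α) (pauli_isHermitian β) t ht
  change _ ≤ c * ‖(sigma i α : Op N)‖ * ‖(sigma j β : Op N)‖ * _ at h1
  rwa [norm_sigma, norm_sigma, mul_one, mul_one] at h1

lemma real_inner_euclidean_eq_re_inner {ι : Type*} [Fintype ι] (x y : EuclideanSpace ℂ ι) :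
    inner ℝ x y = (inner ℂ x y).re := by
  rw [PiLp.inner_apply, PiLp.inner_apply, Complex.re_sum]
  exact Finset.sum_congr rfl fun i _ => real_inner_eq_re_inner ℂ (x i) (y i)

lemma hasDerivAt_hs {f : ℝ → Op N} {f' : Op N} {t : ℝ} (hf : HasDerivAt f f' t) :
    HasDerivAt (fun s => hs (f s)) (hs f') t :=
  ((LinearMap.toContinuousLinearMap hs).restrictScalars ℝ).hasFDerivAt.comp_hasDerivAt t hf

/-- Up to the damping factor, dissipative and closed evolution stay close. -/
lemma norm_hs_forwardMap_sub_le (D : Dissipation) {g h a c ξ v Γ : ℝ} (ha : 0 < a) (hc : 0 < c)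
    (hξ : 0 < ξ) (hv : 0 < v) (hΓ : 0 < Γ) (hLR : IsLiebRobinson g h a c ξ v) (j : Fin N) (β : Axis)
    {T : ℝ} (hT : 0 ≤ T) :
    ‖hs (forwardMap N D g h Γ T (sigma j β) -
      ((Real.exp (-(Γ * (v * T ^ 2 / a + T) / 2)) : ℝ) : ℂ) •
        closedEvolution N g h T (sigma j β))‖ ≤
      1 - Real.exp (-(Γ * (v * T ^ 2 / a + T) / 2)) + Γ * (2 * c * (1 + ξ / a)) * T := by
  set τ := 2 * c * (1 + ξ / a) with hτ
  have hτ0 : 0 ≤ τ := by positivity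
  let lam : ℝ → ℝ := fun s => Real.exp (-(Γ * (v * s ^ 2 / a + s) / 2))
  let p : ℝ → ℝ := fun s => 2 * (v * s) / a + 1
  let X : ℝ → Op N := fun s => forwardMap N D g h Γ s (sigma j β)
  let b : ℝ → Op N := fun s => closedEvolution N g h s (sigma j β)
  let H : Op N := isingH N g h
  let 𝓓 : Op N → Op N := fun O => ∑ k, (siteReflection D k O - O)
  have hlam1 : ∀ s, 0 ≤ s → lam s ≤ 1 := fun s hs0 => by
    simp only [lam]
    rw [Real.exp_le_one_iff]
    have : 0 ≤ Γ * (v * s ^ 2 / a + s) / 2 := by positivity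
    linarith
  have hlam : ∀ s, HasDerivAt lam (-(Γ / 2 * p s * lam s)) s := fun s => by
    have h1 : HasDerivAt (fun s : ℝ => -(Γ * (v * s ^ 2 / a + s) / 2)) (-(Γ / 2 * p s)) s := by
      have h2 := ((((((hasDerivAt_id s).pow 2).const_mul v).div_const a).add
        (hasDerivAt_id s)).const_mul Γ).div_const 2
      refine h2.neg.congr_deriv ?_
      simp [p]
      ring
    refine h1.exp.congr_deriv ?_
    simp only [lam]
    ring
  have hX : ∀ s, HasDerivAt X ((-Complex.I) • comm H (X s) + ((Γ / 2 : ℝ) : ℂ) • 𝓓 (X s)) s :=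
    fun s => by
      have := hasDerivAt_forwardMap D g h Γ s (sigma j β)
      rwa [liouvillian_apply] at this
  -- The equation λ' = -(Γ/2) p λ is what assembles the source term into 𝓓 b + p b.
  have hu : ∀ s, HasDerivAt (fun s => X s - ((lam s : ℝ) : ℂ) • b s)
      ((-Complex.I) • comm H (X s - ((lam s : ℝ) : ℂ) • b s) +
        ((Γ / 2 : ℝ) : ℂ) • 𝓓 (X s - ((lam s : ℝ) : ℂ) • b s) +
        ((Γ / 2 * lam s : ℝ) : ℂ) • (𝓓 (b s) + ((p s : ℝ) : ℂ) • b s)) s := fun s => by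
    have h1 := (hX s).sub ((hlam s).smul (hasDerivAt_closedEvolution g h s (sigma j β)))
    have h2 : ∀ (x : ℝ) (O : Op N), x • O = (x : ℂ) • O := fun x O => (Complex.coe_smul x O).symm
    have h3 : 𝓓 (X s - ((lam s : ℝ) : ℂ) • b s) = 𝓓 (X s) - ((lam s : ℝ) : ℂ) • 𝓓 (b s) := by
      simp only [𝓓, siteReflection_sub, siteReflection_smul, Finset.smul_sum,
        ← Finset.sum_sub_distrib]
      exact Finset.sum_congr rfl fun k _ => by module
    have h4 : comm H (X s - ((lam s : ℝ) : ℂ) • b s) =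
        comm H (X s) - ((lam s : ℝ) : ℂ) • comm H (b s) := by
      simp only [comm, mul_sub, sub_mul, mul_smul_comm, smul_mul_assoc]
      module
    have h5 : (-Complex.I) • comm H (X s) + ((Γ / 2 : ℝ) : ℂ) • 𝓓 (X s) -
        (((lam s : ℝ) : ℂ) • (-Complex.I) • comm H (b s) +
          ((-(Γ / 2 * p s * lam s) : ℝ) : ℂ) • b s) =
        (-Complex.I) • comm H (X s - ((lam s : ℝ) : ℂ) • b s) +
        ((Γ / 2 : ℝ) : ℂ) • 𝓓 (X s - ((lam s : ℝ) : ℂ) • b s) +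
        ((Γ / 2 * lam s : ℝ) : ℂ) • (𝓓 (b s) + ((p s : ℝ) : ℂ) • b s) := by
      rw [h3, h4]
      push_cast
      module
    rw [← h5, ← h2, ← h2, ← h2]
    exact h1
  -- φ is a primitive bounding the source (Γ/2) λ (p + 2τ): the p part integrates exactly to -λ, and
  -- λ ≤ 1 is used on the tail part only.
  have hφ : ∀ s, HasDerivAt (fun s => -lam s + Γ * τ * s) (Γ / 2 * p s * lam s + Γ * τ) s :=
    fun s => by
      refine ((hlam s).neg.add ((hasDerivAt_id s).const_mul (Γ * τ))).congr_deriv ?_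
      simp
  have hmain := norm_le_of_inner_deriv_le hT (fun s => hasDerivAt_hs (hu s)) hφ
    (fun s hs0 => by
      have h1 := hlam1 s hs0
      have h2 : lam 0 = 1 := by simp [lam]
      have h3 : 0 ≤ Γ * τ * s := by positivity
      rw [h2]
      linarith)
    (fun s hs0 _ => by
      set u := X s - ((lam s : ℝ) : ℂ) • b s
      have hl0 : 0 < lam s := Real.exp_pos _
      have h1 : (inner ℂ (hs u) (hs (𝓓 u))).re ≤ 0 := by
        simp only [𝓓]
        rw [map_sum, inner_sum, Complex.re_sum]
        exact Finset.sum_nonpos fun k _ => re_inner_siteReflection_sub_nonpos D k u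
      have h2 := norm_hs_sum_siteReflection_le D j ha hc hξ (mul_nonneg hv.le hs0)
        (norm_hs_closedEvolution_sigma g h s j β) (fun k α => hLR.norm_comm_sigma_le hs0 k j α β)
      have h3 : (inner ℂ (hs u) (hs (𝓓 (b s) + ((p s : ℝ) : ℂ) • b s))).re ≤
          ‖hs u‖ * (p s + 2 * τ) := by
        refine (@re_inner_le_norm ℂ _ _ _ _ _ _).trans
          (mul_le_mul_of_nonneg_left (h2.trans (le_of_eq ?_)) (norm_nonneg _))
        simp only [p, hτ]
        ring
      rw [real_inner_euclidean_eq_re_inner, map_add, map_add, inner_add_right, inner_add_right]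
      rw [Complex.add_re, Complex.add_re, re_inner_comm _ _ (isingH_isHermitian N g h), map_smul hs, map_smul hs, inner_smul_right,
        inner_smul_right, Complex.re_ofReal_mul, Complex.re_ofReal_mul]
      have h4 := mul_le_mul_of_nonneg_left h3 (by positivity : 0 ≤ Γ / 2 * lam s)
      have h5 := mul_nonpos_of_nonneg_of_nonpos (by positivity : 0 ≤ Γ / 2) h1
      have h6 : 0 ≤ ‖hs u‖ * (Γ * τ) * (1 - lam s) :=
        mul_nonneg (by positivity) (by linarith [hlam1 s hs0])
      nlinarith [h4, h5, h6])
  have h0 : X 0 - ((lam 0 : ℝ) : ℂ) • b 0 = 0 := by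
    simp [X, lam, b, forwardMap_zero, closedEvolution_zero]
  have hl0 : lam 0 = 1 := by simp [lam]
  rw [h0, map_zero, norm_zero, hl0] at hmain
  refine hmain.trans (le_of_eq ?_)
  simp only [lam]
  ring

end Dissipator

/-! ### From closeness of operators to the revealed light cone. -/

section Comparison

variable {N : ℕ}

/-- Rescaling by λ instead of ‖x‖ splits the difference into a radial error |‖x‖ - λ| and the given
one, both at most ελ, so no factor 1/(1 - ε) appears. -/
lemma norm_normalize_sub_le {E : Type*} [NormedAddCommGroup E] [NormedSpace ℂ E] {x b : E}
    {lam ε : ℝ} (hlam : 0 < lam) (hb : ‖b‖ = 1) (hx : 0 < ‖x‖)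
    (h : ‖x - (lam : ℂ) • b‖ ≤ ε * lam) :
    ‖((‖x‖⁻¹ : ℝ) : ℂ) • x - b‖ ≤ 2 * ε := by
  have hnl : ‖(lam : ℂ) • b‖ = lam := by
    rw [norm_smul, hb, mul_one, Complex.norm_real, Real.norm_eq_abs, abs_of_pos hlam]
  have h1 : |‖x‖ - lam| ≤ ε * lam := by
    have := abs_norm_sub_norm_le x ((lam : ℂ) • b)
    rw [hnl] at this
    exact this.trans h
  have h2 : (lam : ℂ) • (((‖x‖⁻¹ : ℝ) : ℂ) • x - b) =
      ((lam * ‖x‖⁻¹ - 1 : ℝ) : ℂ) • x + (x - (lam : ℂ) • b) := by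
    push_cast
    module
  have h3 : ‖((lam * ‖x‖⁻¹ - 1 : ℝ) : ℂ) • x‖ = |‖x‖ - lam| := by
    rw [norm_smul, Complex.norm_real, Real.norm_eq_abs]
    nth_rewrite 2 [← abs_of_pos hx]
    rw [← abs_mul, sub_mul, inv_mul_cancel_right₀ hx.ne', one_mul, abs_sub_comm]
  have h4 : lam * ‖((‖x‖⁻¹ : ℝ) : ℂ) • x - b‖ ≤ lam * (2 * ε) := by
    have h5 := norm_add_le (((lam * ‖x‖⁻¹ - 1 : ℝ) : ℂ) • x) (x - (lam : ℂ) • b)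
    rw [← h2, norm_smul, Complex.norm_real, Real.norm_eq_abs, abs_of_pos hlam, h3] at h5
    linarith
  exact le_of_mul_le_mul_left h4 hlam

lemma norm_hs_sigma_conj (i : Fin N) (α : Axis) (X : Op N) :
    ‖hs (sigma i α * X * sigma i α)‖ = ‖hs X‖ := by
  rw [norm_hs_mul_of_mem_unitary' (sigma_mem_unitary i α),
    norm_hs_mul_of_mem_unitary (sigma_mem_unitary i α)]

lemma abs_re_inner_sigma_conj_sub_le (i : Fin N) (α : Axis) {X b : Op N} {ε : ℝ}
    (hX : ‖hs X‖ = 1) (hb : ‖hs b‖ = 1) (h : ‖hs (X - b)‖ ≤ 2 * ε) :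
    |(inner ℂ (hs X) (hs (sigma i α * X * sigma i α))).re -
      (inner ℂ (hs b) (hs (sigma i α * b * sigma i α))).re| ≤ 4 * ε := by
  have h1 : inner ℂ (hs X) (hs (sigma i α * X * sigma i α)) -
      inner ℂ (hs b) (hs (sigma i α * b * sigma i α)) =
      inner ℂ (hs (X - b)) (hs (sigma i α * X * sigma i α)) +
      inner ℂ (hs b) (hs (sigma i α * (X - b) * sigma i α)) := by
    rw [mul_sub, sub_mul, map_sub, map_sub, inner_sub_left, inner_sub_right]
    ring
  rw [← Complex.sub_re, h1]
  refine (Complex.abs_re_le_norm _).trans ((norm_add_le _ _).trans ?_)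
  have h2 := norm_inner_le_norm (𝕜 := ℂ) (hs (X - b)) (hs (sigma i α * X * sigma i α))
  have h3 := norm_inner_le_norm (𝕜 := ℂ) (hs b) (hs (sigma i α * (X - b) * sigma i α))
  rw [norm_hs_sigma_conj, hX] at h2
  rw [norm_hs_sigma_conj, hb] at h3
  linarith

lemma revealed_of_norm_hs_sub_le (D : Dissipation) (g h Γ t : ℝ) (i j : Fin N) (α β : Axis)
    {lam ε : ℝ} (hlam : 0 < lam) (hε0 : 0 < ε) (hε1 : ε < 1)
    (hu : ‖hs (forwardMap N D g h Γ t (sigma j β) -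
      (lam : ℂ) • closedEvolution N g h t (sigma j β))‖ ≤ ε * lam) :
    (frob (comm (closedEvolution N g h t (sigma j β)) (sigma i α)) - 2 * ε) / (1 + ε) ≤
      correctedSignal N D g h Γ t (sigma i α) (sigma j β) ∧
    correctedSignal N D g h Γ t (sigma i α) (sigma j β) ≤
      (frob (comm (closedEvolution N g h t (sigma j β)) (sigma i α)) + 2 * ε) / (1 - ε) ∧
    |correctedOtoc N D g h Γ t (sigma i α) (sigma j β) -
      closedOtoc N g h t (sigma i α) (sigma j β)| ≤ 4 * ε := by
  have hX := norm_hs_forwardMap_pos D g h Γ t j β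
  rw [correctedSignal_eq, frob_eq_norm_hs, closedOtoc_eq, correctedOtoc, otoc_one,
    otoc_eq _ _ _ _ _ (sigma_conjTranspose i α)]
  have hb := norm_hs_closedEvolution_sigma g h t j β
  set X := forwardMap N D g h Γ t (sigma j β)
  set b := closedEvolution N g h t (sigma j β)
  have hnl : ∀ O : Op N, ‖hs ((lam : ℂ) • O)‖ = lam * ‖hs O‖ := fun O => by
    rw [map_smul, norm_smul, Complex.norm_real, Real.norm_eq_abs, abs_of_pos hlam]
  have h1 : |‖hs X‖ - lam| ≤ ε * lam := by
    have := abs_norm_sub_norm_le (hs X) (hs ((lam : ℂ) • b))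
    rw [hnl, hb, mul_one, ← map_sub] at this
    exact this.trans hu
  have h2 : |‖hs (comm X (sigma i α))‖ - lam * ‖hs (comm b (sigma i α))‖| ≤ 2 * (ε * lam) := by
    have := abs_norm_sub_norm_le (hs (comm X (sigma i α)))
      (hs (comm ((lam : ℂ) • b) (sigma i α)))
    rw [← map_sub, ← comm_sub_left, comm_smul_left, hnl] at this
    exact this.trans ((norm_hs_comm_le _ i α).trans (by linarith))
  rw [abs_le] at h1 h2
  set C := ‖hs (comm b (sigma i α))‖
  set S := ‖hs (comm X (sigma i α))‖ with hS
  have hS0 : 0 ≤ S := norm_nonneg _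
  have hC0 : 0 ≤ C := norm_nonneg _
  refine ⟨?_, ?_, ?_⟩
  · rw [div_le_div_iff₀ (by linarith) hX]
    -- The upper bound on ‖X‖ may be inserted only when its factor is nonnegative; otherwise the
    -- claim is trivial.
    rcases le_total (C - 2 * ε) 0 with hneg | hpos
    · have h3 := mul_nonpos_of_nonpos_of_nonneg hneg hX.le
      have h4 : 0 ≤ S * (1 + ε) := by positivity
      linarith
    · calc (C - 2 * ε) * ‖hs X‖ ≤ (C - 2 * ε) * (lam * (1 + ε)) :=
            mul_le_mul_of_nonneg_left (by linarith) hpos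
        _ = (lam * C - 2 * (ε * lam)) * (1 + ε) := by ring
        _ ≤ S * (1 + ε) := mul_le_mul_of_nonneg_right (by linarith) (by linarith)
  · rw [div_le_div_iff₀ hX (by linarith)]
    calc S * (1 - ε) ≤ (lam * C + 2 * (ε * lam)) * (1 - ε) :=
          mul_le_mul_of_nonneg_right (by linarith) (by linarith)
      _ = (C + 2 * ε) * (lam * (1 - ε)) := by ring
      _ ≤ (C + 2 * ε) * ‖hs X‖ := mul_le_mul_of_nonneg_left (by linarith) (by linarith)
  · have h3 := norm_normalize_sub_le hlam hb hX (by rwa [← map_smul, ← map_sub])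
    rw [← map_smul, ← map_sub] at h3
    have h4 : ‖hs (((‖hs X‖⁻¹ : ℝ) : ℂ) • X)‖ = 1 := by
      rw [map_smul, norm_smul, Complex.norm_real, norm_inv, norm_norm, inv_mul_cancel₀ hX.ne']
    have h5 := abs_re_inner_sigma_conj_sub_le i α h4 hb h3
    have h6 : (inner ℂ (hs (((‖hs X‖⁻¹ : ℝ) : ℂ) • X))
        (hs (sigma i α * (((‖hs X‖⁻¹ : ℝ) : ℂ) • X) * sigma i α))).re =
        (inner ℂ (hs X) (hs (sigma i α * X * sigma i α))).re / ‖hs X‖ ^ 2 := by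
      rw [mul_smul_comm, smul_mul_assoc, map_smul, map_smul, inner_smul_left, inner_smul_right,
        Complex.conj_ofReal, Complex.re_ofReal_mul, Complex.re_ofReal_mul]
      field_simp
    rwa [h6] at h5

/-- Up to the time `√(εa/(vΓ))`, the relative error is at most `ε`. -/
lemma relative_error_le {a c ξ v ε Γ t q : ℝ} (ha : 0 < a) (hc : 0 < c) (hξ : 0 < ξ) (hv : 0 < v)
    (hε0 : 0 < ε) (hε1 : ε < 1) (hΓ : 0 < Γ) (hq0 : 0 < q) (hq1 : q ≤ 1 / 10)
    (hqc : c * q ≤ 1 / 80) (hΓq : Γ ≤ q ^ 2 * (ε * a * v / max ξ a ^ 2)) (ht : 0 ≤ t)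
    (ht' : t ≤ √(ε * a / (v * Γ))) :
    1 - Real.exp (-(Γ * (v * t ^ 2 / a + t) / 2)) + Γ * (2 * c * (1 + ξ / a)) * t ≤
      ε * Real.exp (-(Γ * (v * t ^ 2 / a + t) / 2)) := by
  set M := max ξ a with hM
  have hM0 : 0 < M := lt_max_of_lt_left hξ
  have hξM : ξ ≤ M := le_max_left _ _
  have haM : a ≤ M := le_max_right _ _
  have ht2 : t ^ 2 ≤ ε * a / (v * Γ) := (Real.le_sqrt ht (by positivity)).1 ht'
  have h1 : Γ * (v * t ^ 2 / a) ≤ ε := by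
    calc Γ * (v * t ^ 2 / a) ≤ Γ * (v * (ε * a / (v * Γ)) / a) := by gcongr
      _ = ε := by field_simp
  -- Of the smallness of Γ only this consequence is used; it controls both the single-site term of p
  -- and the tails.
  have h2 : Γ * t ≤ q * ε * a / M := by
    refine le_of_sq_le_sq ?_ (by positivity)
    calc (Γ * t) ^ 2 = Γ ^ 2 * t ^ 2 := by ring
      _ ≤ Γ ^ 2 * (ε * a / (v * Γ)) := by gcongr
      _ = Γ * (ε * a / v) := by field_simp
      _ ≤ q ^ 2 * (ε * a * v / M ^ 2) * (ε * a / v) := by gcongr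
      _ = (q * ε * a / M) ^ 2 := by field_simp
  have h3 : Γ * t ≤ ε / 10 := by
    refine h2.trans ((div_le_iff₀ hM0).2 ?_)
    calc q * ε * a ≤ (1 / 10) * ε * M := by gcongr
      _ = ε / 10 * M := by ring
  have h4 : Γ * (2 * c * (1 + ξ / a)) * t ≤ ε / 20 := by
    have h5 : 1 + ξ / a ≤ 2 * M / a := by
      rw [le_div_iff₀ ha, add_mul, div_mul_cancel₀ _ ha.ne']
      linarith
    calc Γ * (2 * c * (1 + ξ / a)) * t = 2 * c * (1 + ξ / a) * (Γ * t) := by ring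
      _ ≤ 2 * c * (2 * M / a) * (q * ε * a / M) := by gcongr
      _ = 4 * (c * q) * ε := by field_simp; ring
      _ ≤ 4 * (1 / 80) * ε := by gcongr
      _ = ε / 20 := by ring
  set η := Γ * (v * t ^ 2 / a + t) / 2 with hη
  have hη0 : 0 ≤ η := by positivity
  -- Half of ε + ε/10, from the quadratic and the linear term of the exponent.
  have hη1 : η ≤ 11 / 20 * ε := by
    rw [hη, mul_add]
    linarith
  have h6 : Real.exp η ≤ 1 + η + η ^ 2 := by
    have := Real.abs_exp_sub_one_sub_id_le (x := η) (by rw [abs_of_nonneg hη0]; linarith)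
    linarith [le_abs_self (Real.exp η - 1 - η)]
  have h7 : η ^ 2 ≤ 121 / 400 * ε := by nlinarith
  have h8 : Real.exp η * (1 + ε / 20) ≤ 1 + ε := by
    calc Real.exp η * (1 + ε / 20) ≤ (1 + (11 / 20 * ε + 121 / 400 * ε)) * (1 + ε / 20) := by
          gcongr
          linarith
      _ ≤ 1 + ε := by nlinarith
  have h9 : Real.exp η * Real.exp (-η) = 1 := by rw [← Real.exp_add, add_neg_cancel, Real.exp_zero]
  have h10 := mul_le_mul_of_nonneg_right h8 (Real.exp_pos (-η)).le
  have h11 : Real.exp η * (1 + ε / 20) * Real.exp (-η) = 1 + ε / 20 := by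
    rw [mul_right_comm, h9, one_mul]
  linarith

lemma revealedAt_of_le (D : Dissipation) {g h a c ξ v ε Γ t q : ℝ} (ha : 0 < a) (hc : 0 < c)
    (hξ : 0 < ξ) (hv : 0 < v) (hLR : IsLiebRobinson g h a c ξ v)
    (hε0 : 0 < ε) (hε1 : ε < 1) (hΓ : 0 < Γ) (hq0 : 0 < q) (hq1 : q ≤ 1 / 10)
    (hqc : c * q ≤ 1 / 80) (hΓq : Γ ≤ q ^ 2 * (ε * a * v / max ξ a ^ 2)) (ht : 0 ≤ t)
    (ht' : t ≤ √(ε * a / (v * Γ))) : RevealedAt D g h a c ξ v ε Γ t := by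
  intro N i j α β
  have h1 := (norm_hs_forwardMap_sub_le D ha hc hξ hv hΓ hLR j β ht).trans
    (relative_error_le ha hc hξ hv hε0 hε1 hΓ hq0 hq1 hqc hΓq ht ht')
  obtain ⟨h2, h3, h4⟩ := revealed_of_norm_hs_sub_le D g h Γ t i j α β (Real.exp_pos _) hε0 hε1 h1
  refine ⟨otoc_one_pos D g h Γ t j β, h2, h3, h4, h3.trans ?_⟩
  refine div_le_div_of_nonneg_right ?_ (by linarith)
  rw [frob_eq_norm_hs]
  linarith [(norm_hs_le _).trans (hLR.norm_comm_sigma_le ht i j α β)]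

lemma le_lightConeWidth (D : Dissipation) {g h a c ξ v ε Γ : ℝ} (ha : 0 < a) (hv : 0 < v)
    (hε0 : 0 < ε) (hΓ : 0 < Γ)
    (hrev : ∀ t : ℝ, 0 ≤ t → t ≤ √(ε * a / (v * Γ)) → RevealedAt D g h a c ξ v ε Γ t) :
    ENNReal.ofReal √(ε * a * v / Γ) ≤ lightConeWidth D g h a c ξ v ε Γ := by
  -- This radius is v times the time √(εa/(vΓ)).
  refine le_iSup₂_of_le (√(ε * a * v / Γ)) (fun t ht htR => hrev t ht ?_) le_rfl
  rw [Real.le_sqrt (by positivity) (by positivity)] at htR ⊢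
  rw [le_div_iff₀ hΓ] at htR
  rw [le_div_iff₀ (by positivity)]
  have h1 : v * (t ^ 2 * (v * Γ)) ≤ v * (ε * a) := by linarith
  exact le_of_mul_le_mul_left h1 hv

end Comparison

end DissipativeOTOC

open DissipativeOTOC in
theorem corollary1 :
    -- the chain has a Lieb-Robinson velocity
    (∀ g h a : ℝ, 0 < a → ∃ c ξ v : ℝ, 0 < c ∧ 0 < ξ ∧ 0 < v ∧ IsLiebRobinson g h a c ξ v) ∧
    -- the backward adjoint map is the forward map
    (∀ (D : Dissipation) (g h Γ t : ℝ) (N : ℕ),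
      backwardAdjointMap N D g h Γ t = forwardMap N D g h Γ t) ∧
    -- the corrected OTOC is well defined and measures a commutator
    (∀ (D : Dissipation) (g h Γ t : ℝ) (N : ℕ) (i j : Fin N) (α β : Axis),
      0 < otoc N D g h Γ t 1 (sigma j β) ∧
      2 * (1 - correctedOtoc N D g h Γ t (sigma i α) (sigma j β)) =
        frob (comm (backwardAdjointMap N D g h Γ t (sigma j β)) (sigma i α)) ^ 2 /
          frob (backwardAdjointMap N D g h Γ t (sigma j β)) ^ 2) ∧
    -- the width of the revealed light cone, for sufficiently small dissipation rate
    (∀ c : ℝ, 0 < c → ∃ κ : ℝ, 0 < κ ∧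
      ∀ (D : Dissipation) (g h a ξ v ε Γ : ℝ), 0 < a → 0 < ξ → 0 < v →
        IsLiebRobinson g h a c ξ v → 0 < ε → ε < 1 →
        0 < Γ → Γ ≤ κ * (ε * a * v / max ξ a ^ 2) →
          (∀ t : ℝ, 0 ≤ t → t ≤ √(ε * a / (v * Γ)) → RevealedAt D g h a c ξ v ε Γ t) ∧
          ENNReal.ofReal √(ε * a * v / Γ) ≤ lightConeWidth D g h a c ξ v ε Γ) := by
  refine ⟨exists_isLiebRobinson, backwardAdjointMap_eq_forwardMap, ?_, ?_⟩
  · intro D g h Γ t N i j α β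
    rw [backwardAdjointMap_eq_forwardMap, frob_eq_norm_hs, frob_eq_norm_hs]
    exact ⟨otoc_one_pos D g h Γ t j β, correctedOtoc_eq D g h Γ t i j α β⟩
  · intro c hc
    have hq0 : 0 < min (1 / 10) (1 / (80 * c)) := by positivity
    have hqc : c * min (1 / 10) (1 / (80 * c)) ≤ 1 / 80 := by
      calc c * min (1 / 10) (1 / (80 * c)) ≤ c * (1 / (80 * c)) :=
            mul_le_mul_of_nonneg_left (min_le_right _ _) hc.le
        _ = 1 / 80 := by field_simp
    -- κ is a square because Γt at the maximal time scales like √Γ.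
    refine ⟨min (1 / 10) (1 / (80 * c)) ^ 2, by positivity, ?_⟩
    intro D g h a ξ v ε Γ ha hξ hv hLR hε0 hε1 hΓ hΓκ
    have hrev : ∀ t : ℝ, 0 ≤ t → t ≤ √(ε * a / (v * Γ)) → RevealedAt D g h a c ξ v ε Γ t :=
      fun t ht ht' => revealedAt_of_le D ha hc hξ hv hLR hε0 hε1 hΓ hq0 (min_le_left _ _) hqc hΓκ
        ht ht'
    exact ⟨hrev, le_lightConeWidth D ha hv hε0 hΓ hrev⟩
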